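/- Write $\mathcal P^n_d$ for the space of $n$-variate real polynomials of degree at most $d$. A *degree-$d$ pseudo-expectation operator* over $\mathbb R^n$ is a linear map $\tilde{\mathbb E}:\mathcal P^n_d\to\mathbb R$ with $\tilde{\mathbb E}[1]=1$ and $\tilde{\mathbb E}[p^2]\ge 0$ for all $p\in\mathcal P^n_{d/2}$; it *satisfies the constraint* $\{p=0\}$, where $p\in\mathcal P^n_d$, if $\tilde{\mathbb E}[pq]=0$ for all $q\in\mathcal P^n_{d-\deg p}$. A *literal* over $x_1,\dots,x_n$ is a function $\{\pm1\}^n\to\{\pm1\}$ of the form $x\mapsto x_i$ or $x\mapsto -x_i$; for a $k$-tuple $C=(f_1,\dots,f_k)$ of literals put $C(x)=(f_1(x),\dots,f_k(x))$. A probability distribution $\mu$ on $\{\pm1\}^k$ is *pairwise independent* if its marginal on every single coordinate is uniform on $\{\pm1\}$ and its marginal on every two distinct coordinates is uniform on $\{\pm1\}^2$. **Theorem.** For every $k\in\mathbb N$ and $\epsilon>0$ there exists $\delta=\delta(k,\epsilon)>0$ such that for every sufficiently large $n\in\mathbb N$ there is a nonempty finite set $\mathcal I=\{C_1,\dots,C_m\}$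 of $k$-tuples of literals over $x_1,\dots,x_n$ such that: 1. For every $x\in\{\pm1\}^n$, the distribution of $C(x)$, where $C$ is chosen uniformly at random in $\mathcal I$, is within statistical (total variation) distance $\epsilon$ of the uniform distribution over $\{\pm1\}^k$. 2. For every pairwise independent distribution $\mu$ over $\{\pm1\}^k$ there exists a degree-$\delta n$ pseudo-expectation operator $\tilde{\mathbb E}$ over $\mathbb R^n$ satisfying the constraints $\{x_j^2=1\}$ for $j=1,\dots,n$, such that for every $C\in\mathcal I$ and every $f:\{\pm1\}^k\to\mathbb R$, $$\tilde{\mathbb E}\, f(C(x))=\mathbb E_{y\sim\mu} f(y).$$ Here $f(C(x))$ denotes the polynomial obtained by substituting the literals of $C$ into the multilinear polynomial that represents $f$ on $\{\pm1\}^k$; its degree is at most $k\le\delta n$. -/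

import Mathlib

open scoped BigOperators

noncomputable section

namespace SOS

/-- A literal over the variables `x_0, …, x_{n-1}`: the function `x ↦ sign * x var` on
`{±1}^n`, where `{±1}` is the type `ℤˣ`. -/
structure Literal (n : ℕ) where
  var : Fin n
  sign : ℤˣ

/-- The value of a literal at an assignment. -/
def Literal.eval {n : ℕ} (l : Literal n) (x : Fin n → ℤˣ) : ℤˣ := l.sign * x l.var

/-- A `k`-tuple of literals over `n` variables. -/
abbrev Clause (k n : ℕ) : Type := Fin k → Literal n

/-- The tuple `C(x)` of the values of the literals of `C`. -/
def Clause.eval {k n : ℕ} (C : Clause k n) (x : Fin n → ℤˣ) : Fin k → ℤˣ :=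
  fun j => (C j).eval x

/-- The statistical (total variation) distance between two distributions on a finite type. -/
def statDist {α : Type*} [Fintype α] (p q : PMF α) : ℝ :=
  (1 / 2) * ∑ a, |(p a).toReal - (q a).toReal|

/-- The distribution of `C(x)` for a uniformly random `C` in a nonempty finite set `I`. -/
def inducedDist {k n : ℕ} (I : Finset (Clause k n)) (hI : I.Nonempty) (x : Fin n → ℤˣ) :
    PMF (Fin k → ℤˣ) :=
  (PMF.uniformOfFinset I hI).map (fun C => C.eval x)

/-- Pairwise independence of a distribution on `{±1}^k`: the marginal on any two distinct
coordinates is uniform on `{±1}^2`, and each single coordinate is uniform (the latter follows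
from the former as soon as `k ≥ 2`). -/
structure IsPairwiseIndependent {k : ℕ} (μ : PMF (Fin k → ℤˣ)) : Prop where
  coord : ∀ i, μ.map (fun y => y i) = PMF.uniformOfFintype ℤˣ
  pair : ∀ i j, i ≠ j → μ.map (fun y => (y i, y j)) = PMF.uniformOfFintype (ℤˣ × ℤˣ)

/-- The expectation of `f` under a distribution on a finite type. -/
def expect {α : Type*} [Fintype α] (μ : PMF α) (f : α → ℝ) : ℝ := ∑ a, (μ a).toReal * f a

/-- The space of `n`-variate real polynomials of total degree at most `d`. -/
abbrev PolyLE (n d : ℕ) : Submodule ℝ (MvPolynomial (Fin n) ℝ) :=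
  MvPolynomial.restrictTotalDegree (Fin n) ℝ d

theorem one_mem_polyLE (n d : ℕ) : (1 : MvPolynomial (Fin n) ℝ) ∈ PolyLE n d := by
  simp [PolyLE, MvPolynomial.mem_restrictTotalDegree]

theorem sq_mem_polyLE {n d : ℕ} {p : MvPolynomial (Fin n) ℝ} (hp : p ∈ PolyLE n (d / 2)) :
    p ^ 2 ∈ PolyLE n d := by
  rw [MvPolynomial.mem_restrictTotalDegree] at *
  have := MvPolynomial.totalDegree_pow p 2
  omega

theorem mul_mem_polyLE {n d : ℕ} {p q : MvPolynomial (Fin n) ℝ} (hp : p ∈ PolyLE n d)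
    (hq : q ∈ PolyLE n (d - p.totalDegree)) : p * q ∈ PolyLE n d := by
  rw [MvPolynomial.mem_restrictTotalDegree] at *
  have := MvPolynomial.totalDegree_mul p q
  omega

/-- `E` is a degree-`d` pseudo-expectation operator. -/
structure IsPseudoExpectation {n d : ℕ} (E : PolyLE n d →ₗ[ℝ] ℝ) : Prop where
  normalization : E ⟨1, one_mem_polyLE n d⟩ = 1
  positivity : ∀ (p : MvPolynomial (Fin n) ℝ) (hp : p ∈ PolyLE n (d / 2)),
    0 ≤ E ⟨p ^ 2, sq_mem_polyLE hp⟩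

/-- `E` satisfies the constraint `p = 0`, where `p` has degree at most `d`. -/
def Satisfies {n d : ℕ} (E : PolyLE n d →ₗ[ℝ] ℝ) (p : MvPolynomial (Fin n) ℝ) : Prop :=
  ∃ hp : p ∈ PolyLE n d,
    ∀ (q : MvPolynomial (Fin n) ℝ) (hq : q ∈ PolyLE n (d - p.totalDegree)),
      E ⟨p * q, mul_mem_polyLE hp hq⟩ = 0

/-- The sign `±1` as a real number. -/
def signReal (u : ℤˣ) : ℝ := ((u : ℤ) : ℝ)

/-- A literal as a polynomial: `sign * X_var`. -/
def Literal.poly {n : ℕ} (l : Literal n) : MvPolynomial (Fin n) ℝ :=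
  MvPolynomial.C (signReal l.sign) * MvPolynomial.X l.var

/-- The function `x ↦ f(C(x))` as a polynomial: the multilinear interpolation
`∑_y f(y) ∏_j (1 + y_j z_j)/2` of `f`, with the `j`-th literal of `C` substituted for `z_j`. -/
def Clause.poly {k n : ℕ} (C : Clause k n) (f : (Fin k → ℤˣ) → ℝ) : MvPolynomial (Fin n) ℝ :=
  ∑ y : Fin k → ℤˣ, MvPolynomial.C (f y) *
    ∏ j, (MvPolynomial.C (1 / 2) * (1 + MvPolynomial.C (signReal (y j)) * (C j).poly))

/-- The polynomial `C.poly f` has degree at most `k`. -/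
theorem Clause.poly_mem {k n : ℕ} (C : Clause k n) (f : (Fin k → ℤˣ) → ℝ) :
    C.poly f ∈ PolyLE n k := by
  refine Submodule.sum_mem _ fun y _ => ?_
  rw [MvPolynomial.mem_restrictTotalDegree]
  refine (MvPolynomial.totalDegree_mul _ _).trans ?_
  rw [MvPolynomial.totalDegree_C, zero_add]
  refine (MvPolynomial.totalDegree_finsetProd _ _).trans ?_
  refine (Finset.sum_le_card_nsmul _ _ 1 fun j _ => ?_).trans (by simp)
  refine (MvPolynomial.totalDegree_mul _ _).trans ?_
  rw [MvPolynomial.totalDegree_C, zero_add]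
  refine (MvPolynomial.totalDegree_add _ _).trans (max_le (by simp) ?_)
  refine (MvPolynomial.totalDegree_mul _ _).trans ?_
  rw [MvPolynomial.totalDegree_C, zero_add]
  refine (MvPolynomial.totalDegree_mul _ _).trans ?_
  rw [MvPolynomial.totalDegree_C, zero_add, MvPolynomial.totalDegree_X]

/-- The polynomial `C.poly f` takes the value `f(C(x))` at every assignment `x`. -/
theorem Clause.eval_poly {k n : ℕ} (C : Clause k n) (f : (Fin k → ℤˣ) → ℝ) (x : Fin n → ℤˣ) :
    MvPolynomial.eval (fun i => signReal (x i)) (C.poly f) = f (C.eval x) := by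
  classical
  have key : ∀ y : Fin k → ℤˣ,
      (∏ j, (1 / 2 : ℝ) * (1 + signReal (y j) * (signReal (C j).sign * signReal (x (C j).var))))
        = if y = C.eval x then 1 else 0 := by
    intro y
    have h1 : ∀ a b c : ℤˣ, (1 / 2 : ℝ) * (1 + signReal a * (signReal b * signReal c))
        = if a = b * c then 1 else 0 := by
      intro a b c
      rcases Int.units_eq_one_or a with rfl | rfl <;> rcases Int.units_eq_one_or b with rfl | rfl <;>
        rcases Int.units_eq_one_or c with rfl | rfl <;> norm_num [signReal]
    simp only [h1]
    split_ifs with h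
    · subst h
      exact Finset.prod_eq_one fun j _ => by simp [Clause.eval, Literal.eval]
    · obtain ⟨j, hj⟩ := Function.ne_iff.mp h
      exact Finset.prod_eq_zero (Finset.mem_univ j) (if_neg hj)
  simp only [Clause.poly, Literal.poly, map_sum, map_mul, map_prod, map_add, map_one,
    MvPolynomial.eval_C, MvPolynomial.eval_X, key]
  simp

end SOS

end

open scoped BigOperators

noncomputable section

namespace SOS

set_option linter.unusedSectionVars false

/-! The instance is a random `k`-partite hypergraph with linearly many edges and random signs on its
incidences. Small edge sets cover at least `k - 5/4` vertices per edge (`exists_expanding`), and a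
Chernoff bound with a union over assignments keeps the clause values nearly uniform
(`exists_signs`). Only the hypergraph matters for expansion, so one instance serves every `μ`.

Given `μ`, each clause carries a density whose nonconstant characters have size at least three, by
pairwise independence. The pseudo-moment `pexp` of a character is its coefficient in the formal
product of all these densities, truncated to terms that are nontrivial on at most `s` clauses. A
nontrivial term has at least three incidences per clause, so expansion forces its boundary, the
variables of odd multiplicity, to have at least half as many elements as the term has clauses
(`card_supp_le`). The loss `5/4` is above `1`, as the random construction needs, and below `3/2`,
where this count breaks down.

Positivity is reduced to genuine local densities. A small variable set lies in a closed pair `(X,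
S)` (`exists_isClosed`): small nontrivial terms avoiding `S` have more boundary outside `X` than
inside. Hence the pseudo-moment of `A + U`, with `A` inside `X`, is a combination of moments under
the density of `S`, in which `U` has been moved into `X` (`pexp_add`), and every nontrivial move
strictly shortens `U`. In Gram–Schmidt by degree, the part of `A` locally orthogonal to the earlier
characters inside `X` is therefore globally orthogonal to all earlier characters, and its square
norm is a local one, so nonnegative (`pform_self_nonneg`).

On a single clause the moments are those of `μ`, since no other small term has its boundary among
the variables of that clause (`pexp_eq_coef`). -/

/-- The support of a vector over `ZMod 2`. -/
def fsupp {V : Type*} [Fintype V] (A : V → ZMod 2) : Finset V := {v | A v ≠ 0}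

theorem mem_fsupp {V : Type*} [Fintype V] {A : V → ZMod 2} {v : V} : v ∈ fsupp A ↔ A v ≠ 0 := by
  simp [fsupp]

/-! ### Characters and local Fourier data. -/

/-- The real character of `{±1}^V` indexed by a vector over `ZMod 2`. -/
def chi {V : Type*} [Fintype V] (A : V → ZMod 2) (x : V → ℤˣ) : ℝ :=
  ∏ v, if A v = 0 then 1 else signReal (x v)

/-- Local Fourier data: every constraint `c` involves the `k` variables `nbr c` and carries a
nonnegative density on `{±1}^V` whose Fourier coefficients `coef c` vanish in degrees
`1` and `2`. -/
structure ConstraintSystem (V ι : Type*) [Fintype V] (k : ℕ) where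
  nbr : ι → Finset V
  card_nbr : ∀ c, (nbr c).card = k
  coef : ι → (V → ZMod 2) → ℝ
  coef_zero : ∀ c, coef c 0 = 1
  three_le_card : ∀ c T, coef c T ≠ 0 → T ≠ 0 → 3 ≤ (fsupp T).card
  fsupp_subset : ∀ c T, coef c T ≠ 0 → fsupp T ⊆ nbr c
  density_nonneg : ∀ [DecidableEq V] c x, 0 ≤ ∑ T, coef c T * chi T x

/-! ### Incidence counting, expansion and closed pairs. -/

namespace ConstraintSystem

variable {V ι : Type*} [Fintype V] [DecidableEq V] [Fintype ι] [DecidableEq ι] {k : ℕ}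

/-- The constraints on which `H` is nonzero. -/
def supp (H : ι → V → ZMod 2) : Finset ι := {c | H c ≠ 0}

/-- The variables occurring an odd number of times in `H`. -/
def bdry (H : ι → V → ZMod 2) : V → ZMod 2 := ∑ c, H c

variable (Φ : ConstraintSystem V ι k)

/-- The product of the Fourier coefficients selected by `H`. -/
def weight (H : ι → V → ZMod 2) : ℝ := ∏ c, Φ.coef c (H c)

/-- The variables involved in a set of constraints. -/
def nbrs (S : Finset ι) : Finset V := S.biUnion Φ.nbr

/-- A constraint whose density is not constant. -/
def Nontrivial (c : ι) : Prop := ∃ T, T ≠ 0 ∧ Φ.coef c T ≠ 0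

/-- Every set of at most `r` constraints, not all of them trivial, involves at least `(k - 5/4)`
variables per constraint. -/
def Expands (r : ℕ) : Prop :=
  ∀ S : Finset ι, S.card ≤ r → (∃ c ∈ S, Φ.Nontrivial c) →
    4 * (k * S.card) ≤ 4 * (Φ.nbrs S).card + 5 * S.card

theorem mem_supp {H : ι → V → ZMod 2} {c : ι} : c ∈ supp H ↔ H c ≠ 0 := by simp [supp]

variable {Φ}

theorem coef_ne_zero {H : ι → V → ZMod 2} (hH : Φ.weight H ≠ 0) (c : ι) : Φ.coef c (H c) ≠ 0 :=
  fun h => hH (Finset.prod_eq_zero (Finset.mem_univ c) h)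

theorem nontrivial_of_mem_supp {H : ι → V → ZMod 2} (hH : Φ.weight H ≠ 0) {c : ι}
    (hc : c ∈ supp H) : Φ.Nontrivial c :=
  ⟨H c, mem_supp.1 hc, coef_ne_zero hH c⟩

/-- The basic incidence count. -/
theorem incidence_count {H : ι → V → ZMod 2} (hH : Φ.weight H ≠ 0) (X : Finset V) :
    2 * (Φ.nbrs (supp H) \ X).card + 3 * (supp H).card + (fsupp (bdry H) ∩ X).card
      ≤ 2 * (k * (supp H).card) + (fsupp (bdry H) \ X).card := by
  set e : V → ℕ := fun v => ((supp H).filter fun c => v ∈ Φ.nbr c).card with he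
  set h : V → ℕ := fun v => ((supp H).filter fun c => H c v ≠ 0).card with hh
  have he_sum : ∑ v, e v = k * (supp H).card := by
    simp only [he, Finset.card_filter]
    rw [Finset.sum_comm]
    simp [Φ.card_nbr, mul_comm]
  have hh_sum : 3 * (supp H).card ≤ ∑ v, h v := by
    simp only [hh, Finset.card_filter]
    rw [Finset.sum_comm, mul_comm, ← smul_eq_mul]
    refine Finset.card_nsmul_le_sum _ _ _ fun c hc => ?_
    refine (Φ.three_le_card c (H c) (coef_ne_zero hH c) (mem_supp.1 hc)).trans (le_of_eq ?_)
    rw [fsupp, Finset.card_filter]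
  -- For a covered `v` outside `X`: if `e v ≥ 2` then `2 + h v ≤ 2 * e v`, and if `e v = 1` the only
  -- excess is `h v = 1`, which puts `v` in the boundary. Inside `X` a boundary variable has `1 ≤ h
  -- v ≤ e v`.
  have pt : ∀ v, 2 * (if v ∈ Φ.nbrs (supp H) \ X then 1 else 0) + h v +
      (if v ∈ fsupp (bdry H) ∩ X then 1 else 0)
      ≤ 2 * e v + (if v ∈ fsupp (bdry H) \ X then 1 else 0) := by
    intro v
    have h_le : h v ≤ e v := by
      refine Finset.card_le_card fun c hc => ?_
      rw [Finset.mem_filter] at hc ⊢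
      exact ⟨hc.1, Φ.fsupp_subset c _ (coef_ne_zero hH c) (mem_fsupp.2 hc.2)⟩
    have h_nbr : v ∈ Φ.nbrs (supp H) → 1 ≤ e v := by
      intro hv
      obtain ⟨c, hc, hv⟩ := Finset.mem_biUnion.1 hv
      exact Finset.card_pos.2 ⟨c, Finset.mem_filter.2 ⟨hc, hv⟩⟩
    have h_zero : v ∈ fsupp (bdry H) → 1 ≤ h v := by
      intro hv
      by_contra! h0
      have h1 : (supp H).filter (fun c => H c v ≠ 0) = ∅ := by
        rw [← Finset.card_eq_zero]; simp only [hh] at h0; omega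
      refine mem_fsupp.1 hv ?_
      rw [bdry, Finset.sum_apply]
      refine Finset.sum_eq_zero fun c _ => ?_
      by_contra hc
      have : c ∈ (supp H).filter (fun c => H c v ≠ 0) :=
        Finset.mem_filter.2 ⟨mem_supp.2 fun h => hc (by simp [h]), hc⟩
      simp [h1] at this
    have h_one : h v = 1 → v ∈ fsupp (bdry H) := by
      intro h1
      obtain ⟨c, hc⟩ := Finset.card_eq_one.1 h1
      have hcm : c ∈ (supp H).filter (fun c => H c v ≠ 0) := by simp [hc]
      rw [mem_fsupp, bdry, Finset.sum_apply, Finset.sum_eq_single c]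
      · exact (Finset.mem_filter.1 hcm).2
      · intro b _ hb
        by_contra h0
        have : b ∈ (supp H).filter (fun c => H c v ≠ 0) :=
          Finset.mem_filter.2 ⟨mem_supp.2 fun h => h0 (by simp [h]), h0⟩
        rw [hc, Finset.mem_singleton] at this
        exact hb this
      · simp
    simp only [Finset.mem_sdiff, Finset.mem_inter]
    by_cases h1 : v ∈ Φ.nbrs (supp H) <;> by_cases h2 : v ∈ X <;>
      by_cases h3 : v ∈ fsupp (bdry H) <;> simp [h1, h2, h3] at * <;> omega
  have key := Finset.sum_le_sum fun v (_ : v ∈ Finset.univ) => pt v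
  simp only [Finset.sum_add_distrib, ← Finset.mul_sum, Finset.sum_ite_mem, Finset.univ_inter,
    Finset.sum_const, smul_eq_mul, mul_one, he_sum] at key
  omega

/-- In the incidence count with `X = ∅`, three incidences per constraint exceed twice the expansion
loss `5/4` by one half. -/
theorem card_supp_le {r : ℕ} (hΦ : Φ.Expands r) {H : ι → V → ZMod 2} (hH : Φ.weight H ≠ 0)
    (hr : (supp H).card ≤ r) : (supp H).card ≤ 2 * (fsupp (bdry H)).card := by
  rcases (supp H).eq_empty_or_nonempty with he | ⟨c, hc⟩
  · simp [he]
  have h1 := incidence_count hH ∅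
  have h2 := hΦ _ hr ⟨c, hc, nontrivial_of_mem_supp hH hc⟩
  simp only [Finset.sdiff_empty, Finset.inter_empty, Finset.card_empty] at h1
  omega

/-- `(X, S)` is closed: a nonzero selection outside `S` has most of its boundary outside `X`. -/
structure IsClosed (Φ : ConstraintSystem V ι k) (s : ℕ) (X : Finset V) (S : Finset ι) : Prop where
  bdry_lt : ∀ H : ι → V → ZMod 2, Φ.weight H ≠ 0 → (supp H).Nonempty → Disjoint (supp H) S →
    (supp H).card ≤ s → (fsupp (bdry H) ∩ X).card < (fsupp (bdry H) \ X).card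
  nbr_subset : Φ.nbrs S ⊆ X

/-- Take a pair with `S` maximal under a budget for `X`. A selection violating closedness could be
added to `S`, and its variables to `X`, and by the incidence count the budget would survive.
Expansion turns the budget into the bound on `S`. -/
theorem exists_isClosed {r s D : ℕ} (hΦ : Φ.Expands r) (hr : 4 * D + s ≤ r) (A : Finset V)
    (hA : A.card ≤ D) :
    ∃ X S, A ⊆ X ∧ S.card ≤ 4 * D ∧ Φ.IsClosed s X S := by
  classical
  let P : Finset (Finset V × Finset ι) := {p | A ⊆ p.1 ∧ Φ.nbrs p.2 ⊆ p.1 ∧ p.2.card ≤ r ∧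
    -- Needed because `Expands` says nothing about sets of trivial constraints.
    (p.2 = ∅ ∨ ∃ c ∈ p.2, Φ.Nontrivial c) ∧
    2 * p.1.card + 3 * p.2.card ≤ 2 * A.card + 2 * (k * p.2.card)}
  have hP : P.Nonempty := ⟨(A, ∅), by simp [P, nbrs]⟩
  obtain ⟨⟨X, S⟩, hXS, hmax⟩ := Finset.exists_max_image P (fun p => p.2.card) hP
  simp only [P, Finset.mem_filter, Finset.mem_univ, true_and] at hXS hmax
  obtain ⟨h1, h2, h3, h5, h4⟩ := hXS
  have hS : S.card ≤ 4 * D := by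
    rcases h5 with rfl | h5
    · simp
    have := hΦ S h3 h5
    have := Finset.card_le_card h2
    omega
  refine ⟨X, S, h1, hS, ⟨fun H hH hne hdisj hs => ?_, h2⟩⟩
  by_contra! hlt
  have hcount := incidence_count hH X
  have hcard : (S ∪ supp H).card = S.card + (supp H).card :=
    Finset.card_union_of_disjoint hdisj.symm
  have hX : (X ∪ Φ.nbrs (supp H)).card = X.card + (Φ.nbrs (supp H) \ X).card := by
    rw [Finset.union_comm, ← Finset.card_sdiff_add_card]; omega
  have hpos := hne.card_pos
  have := hmax (X ∪ Φ.nbrs (supp H), S ∪ supp H) ⟨h1.trans Finset.subset_union_left, ?_, ?_,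
    Or.inr ?_, ?_⟩
  · simp only [hcard] at this
    omega
  · simp only [nbrs, Finset.union_biUnion]
    exact Finset.union_subset_union h2 le_rfl
  · simp only [hcard]; omega
  · obtain ⟨c, hc⟩ := hne
    exact ⟨c, Finset.mem_union_right _ hc, nontrivial_of_mem_supp hH hc⟩
  · simp only [hcard, hX, mul_add]
    omega

/-- A selection with boundary inside the variables of one constraint avoids the others. -/
theorem supp_eq_empty_of_bdry_subset_nbr {r : ℕ} (hΦ : Φ.Expands (r + 1)) {H : ι → V → ZMod 2}
    (hH : Φ.weight H ≠ 0) (hr : (supp H).card ≤ r) (c : ι) (hc : H c = 0)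
    (hb : fsupp (bdry H) ⊆ Φ.nbr c) : supp H = ∅ := by
  by_contra hne
  have hpos := Finset.card_pos.2 (Finset.nonempty_iff_ne_empty.2 hne)
  obtain ⟨b, hbs⟩ := Finset.nonempty_iff_ne_empty.2 hne
  have hbn := nontrivial_of_mem_supp hH hbs
  have h1 := incidence_count hH ∅
  simp only [Finset.sdiff_empty, Finset.inter_empty, Finset.card_empty] at h1
  have h2 := hΦ _ (hr.trans (Nat.le_succ r)) ⟨b, hbs, hbn⟩
  have h3 := incidence_count hH (Φ.nbr c)
  rw [Finset.sdiff_eq_empty_iff_subset.2 hb, Finset.inter_eq_left.2 hb, Finset.card_empty] at h3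
  have hcs : c ∉ supp H := fun h => mem_supp.1 h hc
  have h4 := hΦ (insert c (supp H)) (by rw [Finset.card_insert_of_notMem hcs]; omega)
    ⟨b, Finset.mem_insert_of_mem hbs, hbn⟩
  have h5 : (Φ.nbrs (insert c (supp H))).card = k + (Φ.nbrs (supp H) \ Φ.nbr c).card := by
    rw [nbrs, Finset.biUnion_insert, Finset.union_comm, ← Finset.card_sdiff_add_card,
      Φ.card_nbr, nbrs, add_comm]
  rw [Finset.card_insert_of_notMem hcs, h5, mul_add] at h4
  -- With `t` constraints and `b` boundary variables the counts give `t ≤ 2 * b` and `t + 2 * b ≤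
  -- 5`, so `t ≤ 2`. A single constraint has `b ≥ 3`, and `t = 2` fails by integrality.
  by_cases ht : (supp H).card = 1
  · obtain ⟨c', hc'⟩ := Finset.card_eq_one.1 ht
    have : (Φ.nbrs (supp H)).card = k := by simp [hc', nbrs, Φ.card_nbr]
    simp only [ht, mul_one] at h1 h2 h3 h4
    omega
  · have : (fsupp (bdry H)).card ≤ 1 := by omega
    have : (supp H).card = 2 := by omega
    omega

end ConstraintSystem

/-! ### An abstract positivity criterion. -/

/-- Positivity of a symmetric form by Gram–Schmidt along a rank function. -/
theorem nonneg_of_gramSchmidt {α : Type*} [Fintype α] [DecidableEq α]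
    (B : LinearMap.BilinForm ℝ (α → ℝ)) (hsymm : ∀ p q, B p q = B q p) (rk : α → ℕ) (D : ℕ)
    (step : ∀ S, rk S ≤ D → ∀ F : Finset α, S ∉ F → (∀ T ∈ F, rk T ≤ rk S) →
      (∀ T, rk T < rk S → T ∈ F) → ∃ q : α → ℝ, (∀ T, q T ≠ 0 → T ∈ F) ∧
        (∀ U ∈ F, B (Pi.single S 1 - q) (Pi.single U 1) = 0) ∧
        0 ≤ B (Pi.single S 1 - q) (Pi.single S 1 - q))
    (p : α → ℝ) (hp : ∀ T, p T ≠ 0 → rk T ≤ D) : 0 ≤ B p p := by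
  have main : ∀ F : Finset α, (∀ S ∈ F, rk S ≤ D) → (∀ S ∈ F, ∀ T, rk T < rk S → T ∈ F) →
      ∀ p : α → ℝ, (∀ T, p T ≠ 0 → T ∈ F) → 0 ≤ B p p := by
    intro F
    induction F using Finset.strongInduction with
    | H F ih =>
      intro hD hF p hp
      rcases F.eq_empty_or_nonempty with rfl | hne
      · have : p = 0 := by
          funext T
          by_contra h
          exact absurd (hp T h) (Finset.notMem_empty T)
        simp [this]
      obtain ⟨S, hS, hmax⟩ := Finset.exists_max_image F rk hne
      obtain ⟨q, hq, horth, hnn⟩ := step S (hD S hS) (F.erase S) (Finset.notMem_erase S F)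
        (fun T hT => hmax T (Finset.mem_of_mem_erase hT))
        (fun T hT => Finset.mem_erase.2 ⟨by rintro rfl; exact lt_irrefl _ hT, hF S hS T hT⟩)
      set z : α → ℝ := Pi.single S 1 - q with hz
      have hqS : q S = 0 := by
        by_contra h
        exact Finset.notMem_erase S F (hq S h)
      -- Since `q` avoids `S`, `p'` has no `S`-coordinate. It is orthogonal to `z`, so `B p p` is
      -- the sum of `p S ^ 2 * B z z` and `B p' p'`, and the induction applies to the latter.
      set p' : α → ℝ := p - p S • z with hp'
      have hp'F : ∀ T, p' T ≠ 0 → T ∈ F.erase S := by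
        intro T hT
        by_cases hTS : T = S
        · subst hTS
          exact absurd (by simp [hp', hz, hqS]) hT
        · by_cases hqT : q T = 0
          · refine Finset.mem_erase.2 ⟨hTS, hp T fun h => hT ?_⟩
            simp [hp', hz, hqT, h, hTS]
          · exact hq T hqT
      have hzp' : B z p' = 0 := by
        have : p' = ∑ U, p' U • (Pi.single U (1 : ℝ) : α → ℝ) := by
          funext T
          simp [Finset.sum_apply, Pi.single_apply]
        rw [this, map_sum]
        refine Finset.sum_eq_zero fun U _ => ?_
        by_cases hU : p' U = 0
        · simp [hU]
        · rw [map_smul, horth U (hp'F U hU), smul_zero]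
      have hpe : p = p S • z + p' := by simp [hp']
      have hnn' := ih (F.erase S) (Finset.erase_ssubset hS)
        (fun T hT => hD T (Finset.mem_of_mem_erase hT))
        (fun R hR T hT => Finset.mem_erase.2 ⟨by
          rintro rfl
          exact absurd hT (not_lt.2 (hmax R (Finset.mem_of_mem_erase hR))),
          hF R (Finset.mem_of_mem_erase hR) T hT⟩) p' hp'F
      rw [hpe]
      simp only [map_add, LinearMap.add_apply, map_smul, LinearMap.smul_apply, hsymm p' z, hzp',
        add_zero, smul_eq_mul]
      have := mul_nonneg (mul_self_nonneg (p S)) hnn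
      linarith
  exact main {S | rk S ≤ D} (by simp) (fun S hS T hT => by
    simp only [Finset.mem_filter, Finset.mem_univ, true_and] at hS ⊢; omega) p (by simpa using hp)

/-! ### Multiplicativity and orthogonality of characters. -/

section Characters

variable {V : Type*} [Fintype V]

theorem signReal_mul_self (u : ℤˣ) : signReal u * signReal u = 1 := by
  rcases Int.units_eq_one_or u with rfl | rfl <;> norm_num [signReal]

theorem zmod_two_eq_one {a : ZMod 2} (h : a ≠ 0) : a = 1 := by
  revert h; revert a; decide

@[simp] theorem chi_zero (x : V → ℤˣ) : chi 0 x = 1 := by simp [chi]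

theorem chi_add (A B : V → ZMod 2) (x : V → ℤˣ) : chi (A + B) x = chi A x * chi B x := by
  rw [chi, chi, chi, ← Finset.prod_mul_distrib]
  refine Finset.prod_congr rfl fun v _ => ?_
  by_cases hA : A v = 0 <;> by_cases hB : B v = 0
  · simp [hA, hB]
  · simp [hA, hB]
  · simp [hA, hB]
  · have : (1 : ZMod 2) + 1 = 0 := by decide
    simp [zmod_two_eq_one hA, zmod_two_eq_one hB, this, signReal_mul_self]

theorem chi_sum {ι : Type*} (s : Finset ι) (H : ι → V → ZMod 2) (x : V → ℤˣ) :
    chi (∑ c ∈ s, H c) x = ∏ c ∈ s, chi (H c) x := by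
  classical
  induction s using Finset.induction_on with
  | empty => simp
  | insert c s hc ih => rw [Finset.sum_insert hc, Finset.prod_insert hc, chi_add, ih]

theorem sum_chi [DecidableEq V] (A : V → ZMod 2) :
    ∑ x : V → ℤˣ, chi A x = if A = 0 then 2 ^ Fintype.card V else 0 := by
  have h : ∑ x : V → ℤˣ, chi A x = ∏ v, ∑ u : ℤˣ, if A v = 0 then 1 else signReal u := by
    rw [Finset.prod_univ_sum, Fintype.piFinset_univ]
    rfl
  have h2 : ∀ v, (∑ u : ℤˣ, if A v = 0 then 1 else signReal u) = if A v = 0 then 2 else 0 := by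
    intro v
    by_cases hv : A v = 0
    · simp [hv]
    · have : (Finset.univ : Finset ℤˣ) = {1, -1} := rfl
      simp [hv, this, signReal]
  rw [h]
  simp only [h2]
  split_ifs with hA
  · subst hA
    simp [Finset.card_univ]
  · obtain ⟨v, hv⟩ := Function.ne_iff.1 hA
    exact Finset.prod_eq_zero (Finset.mem_univ v) (if_neg hv)

theorem add_self_eq_zero' (A : V → ZMod 2) : A + A = 0 := by
  funext v
  exact CharTwo.add_self_eq_zero (A v)

theorem fsupp_add_subset [DecidableEq V] (A B : V → ZMod 2) :
    fsupp (A + B) ⊆ fsupp A ∪ fsupp B := by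
  intro v hv
  rw [Finset.mem_union, mem_fsupp, mem_fsupp]
  rw [mem_fsupp] at hv
  by_contra! h
  exact hv (by simp [h])

end Characters

/-! ### Pseudo-moments and their factorization through closed pairs. -/

namespace ConstraintSystem

variable {V ι : Type*} [Fintype V] [DecidableEq V] [Fintype ι] [DecidableEq ι] {k : ℕ}
variable (Φ : ConstraintSystem V ι k)

/-- The pseudo-moment of the character `A`: the total weight of the selections of size at most `s`
with boundary `A`. -/
def pexp (s : ℕ) (A : V → ZMod 2) : ℝ :=
  ∑ H : ι → V → ZMod 2 with Φ.weight H ≠ 0 ∧ (supp H).card ≤ s ∧ bdry H = A, Φ.weight H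

/-- The moment of the character `A` under the density given by the constraints in `S`. -/
def localExp (S : Finset ι) (A : V → ZMod 2) : ℝ :=
  ∑ H : ι → V → ZMod 2 with Φ.weight H ≠ 0 ∧ supp H ⊆ S ∧ bdry H = A, Φ.weight H

/-- The density given by the constraints in `S`. -/
def density (S : Finset ι) (x : V → ℤˣ) : ℝ := ∏ c ∈ S, ∑ T, Φ.coef c T * chi T x

theorem density_nn (S : Finset ι) (x : V → ℤˣ) : 0 ≤ Φ.density S x :=
  Finset.prod_nonneg fun c _ => Φ.density_nonneg c x

theorem density_eq_sum (S : Finset ι) (x : V → ℤˣ) :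
    Φ.density S x = ∑ H : ι → V → ZMod 2 with supp H ⊆ S, Φ.weight H * chi (bdry H) x := by
  -- Off `S` the factor becomes the constant `1`, so the product can be expanded over selections on
  -- all of `ι`.
  let g : ι → (V → ZMod 2) → ℝ := fun c T => if c ∈ S then Φ.coef c T else if T = 0 then 1 else 0
  have h1 : Φ.density S x = ∏ c, ∑ T, g c T * chi T x := by
    rw [density, ← Finset.prod_subset (Finset.subset_univ S)]
    · exact Finset.prod_congr rfl fun c hc => by simp [g, hc]
    · intro c _ hc
      simp [g, hc]
  rw [h1, Finset.prod_univ_sum, Fintype.piFinset_univ, Finset.sum_filter]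
  refine Finset.sum_congr rfl fun H _ => ?_
  rw [Finset.prod_mul_distrib, bdry, chi_sum]
  split_ifs with hH
  · congr 1
    refine Finset.prod_congr rfl fun c _ => ?_
    by_cases hc : c ∈ S
    · simp [g, hc]
    · have : H c = 0 := by
        by_contra h
        exact hc (hH (mem_supp.2 h))
      simp [g, hc, this, Φ.coef_zero]
  · obtain ⟨c, hc, hcS⟩ := Finset.not_subset.1 hH
    rw [Finset.prod_eq_zero (Finset.mem_univ c), zero_mul]
    simp [g, hcS, mem_supp.1 hc]

/-- Orthogonality of characters extracts the selections with boundary `A` from the expanded density.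
Local moments are thus integrals against a nonnegative weight, which is the source of positivity. -/
theorem localExp_eq_sum (S : Finset ι) (A : V → ZMod 2) :
    Φ.localExp S A = ∑ x, Φ.density S x / 2 ^ Fintype.card V * chi A x := by
  have hx : ∀ x, Φ.density S x / 2 ^ Fintype.card V * chi A x =
      ∑ H : ι → V → ZMod 2 with supp H ⊆ S,
        Φ.weight H / 2 ^ Fintype.card V * chi (bdry H + A) x := by
    intro x
    rw [density_eq_sum, Finset.sum_div, Finset.sum_mul]
    refine Finset.sum_congr rfl fun H _ => ?_
    rw [chi_add]; ring
  simp only [hx]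
  rw [Finset.sum_comm]
  simp only [← Finset.mul_sum, sum_chi]
  rw [localExp, Finset.sum_filter, Finset.sum_filter]
  refine Finset.sum_congr rfl fun H _ => ?_
  have h0 : bdry H + A = 0 ↔ bdry H = A := by
    constructor
    · intro h
      have := congrArg (· + A) h
      simpa [add_assoc, add_self_eq_zero'] using this
    · rintro rfl
      exact add_self_eq_zero' _
  by_cases hw : Φ.weight H = 0
  · simp [hw]
  · by_cases h1 : supp H ⊆ S <;> by_cases h2 : bdry H = A <;> simp [h0, h1, h2, hw, add_self_eq_zero']

/-- The part of a selection on the constraints in `S`. -/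
def restr (S : Finset ι) (H : ι → V → ZMod 2) : ι → V → ZMod 2 := fun c => if c ∈ S then H c else 0

theorem supp_restr (S : Finset ι) (H : ι → V → ZMod 2) : supp (restr S H) = supp H ∩ S := by
  ext c
  by_cases hc : c ∈ S <;> simp [mem_supp, restr, hc]

theorem restr_add_restr_compl (S : Finset ι) (H : ι → V → ZMod 2) :
    restr Sᶜ H + restr S H = H := by
  funext c
  by_cases hc : c ∈ S <;> simp [restr, hc]

theorem bdry_add (H H' : ι → V → ZMod 2) : bdry (H + H') = bdry H + bdry H' := by
  simp [bdry, Finset.sum_add_distrib]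

theorem supp_add_subset (H H' : ι → V → ZMod 2) : supp (H + H') ⊆ supp H ∪ supp H' := by
  intro c hc
  rw [Finset.mem_union, mem_supp, mem_supp]
  rw [mem_supp] at hc
  by_contra! h
  exact hc (by simp [h])

variable {Φ}

theorem weight_add {H H' : ι → V → ZMod 2} (h : Disjoint (supp H) (supp H')) :
    Φ.weight (H + H') = Φ.weight H * Φ.weight H' := by
  rw [weight, weight, weight, ← Finset.prod_mul_distrib]
  refine Finset.prod_congr rfl fun c _ => ?_
  by_cases h1 : H c = 0
  · simp [h1, Φ.coef_zero]
  · have h2 : H' c = 0 := by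
      by_contra h2
      exact Finset.disjoint_left.1 h (mem_supp.2 h1) (mem_supp.2 h2)
    simp [h2, Φ.coef_zero]

theorem fsupp_bdry_subset {S : Finset ι} {H : ι → V → ZMod 2} (hw : Φ.weight H ≠ 0)
    (hH : supp H ⊆ S) : fsupp (bdry H) ⊆ Φ.nbrs S := by
  intro v hv
  by_contra h
  refine mem_fsupp.1 hv ?_
  rw [bdry, Finset.sum_apply]
  refine Finset.sum_eq_zero fun c _ => ?_
  by_contra hc
  exact h (Finset.mem_biUnion.2 ⟨c, hH (mem_supp.2 fun h => hc (by simp [h])),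
    Φ.fsupp_subset c _ (coef_ne_zero hw c) (mem_fsupp.2 hc)⟩)

variable (Φ) in
/-- The selections outside `S` that move the character `U` into `X`. -/
def outer (s : ℕ) (X : Finset V) (S : Finset ι) (U : V → ZMod 2) : Finset (ι → V → ZMod 2) :=
  {H | Φ.weight H ≠ 0 ∧ Disjoint (supp H) S ∧ (supp H).card ≤ s ∧ fsupp (U + bdry H) ⊆ X}

theorem fsupp_bdry_sdiff {X : Finset V} {U : V → ZMod 2} {H : ι → V → ZMod 2}
    (h : fsupp (U + bdry H) ⊆ X) : fsupp (bdry H) \ X = fsupp U \ X := by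
  ext v
  simp only [Finset.mem_sdiff]
  refine and_congr_left fun hv => ?_
  have h0 : U v + bdry H v = 0 := by
    by_contra h1
    exact hv (h (mem_fsupp.2 h1))
  rw [mem_fsupp, mem_fsupp, CharTwo.add_eq_zero.1 h0]

/-- Outside `X` the boundary of `H` cancels `U` exactly; inside `X` it adds strictly fewer
variables, by closedness. -/
theorem card_fsupp_lt {s : ℕ} {X : Finset V} {S : Finset ι} (hcl : Φ.IsClosed s X S)
    {U : V → ZMod 2} {H : ι → V → ZMod 2} (hH : H ∈ Φ.outer s X S U) (hne : (supp H).Nonempty) :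
    (fsupp (U + bdry H)).card < (fsupp U).card := by
  simp only [outer, Finset.mem_filter, Finset.mem_univ, true_and] at hH
  obtain ⟨h1, h2, h3, h4⟩ := hH
  have h5 := hcl.bdry_lt H h1 hne h2 h3
  rw [fsupp_bdry_sdiff h4] at h5
  have h6 : fsupp (U + bdry H) ⊆ (fsupp U ∩ X) ∪ (fsupp (bdry H) ∩ X) := by
    rw [← Finset.union_inter_distrib_right]
    exact Finset.subset_inter (fsupp_add_subset _ _) h4
  have h7 := (Finset.card_le_card h6).trans (Finset.card_union_le _ _)
  have h8 := Finset.card_inter_add_card_sdiff (fsupp U) X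
  omega

theorem supp_eq_empty_iff {H : ι → V → ZMod 2} : supp H = ∅ ↔ H = 0 := by
  constructor
  · intro h
    funext c
    by_contra hc
    have := mem_supp.2 hc
    simp [h] at this
  · rintro rfl
    simp [supp]

/-- When `U` already lies in `X`, an outer boundary has nothing outside `X`, which closedness
forbids for nonzero `H`. -/
theorem outer_eq_singleton {s : ℕ} {X : Finset V} {S : Finset ι} (hcl : Φ.IsClosed s X S)
    {U : V → ZMod 2} (hU : fsupp U ⊆ X) : Φ.outer s X S U = {0} := by
  ext H
  rw [Finset.mem_singleton]
  constructor
  · intro hH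
    rw [← supp_eq_empty_iff]
    by_contra hne
    simp only [outer, Finset.mem_filter, Finset.mem_univ, true_and] at hH
    obtain ⟨h1, h2, h3, h4⟩ := hH
    have h5 := hcl.bdry_lt H h1 (Finset.nonempty_iff_ne_empty.2 hne) h2 h3
    rw [fsupp_bdry_sdiff h4, Finset.sdiff_eq_empty_iff_subset.2 hU] at h5
    simp at h5
  · rintro rfl
    simp [outer, supp, bdry, weight, Φ.coef_zero, hU]

/-- Split a selection into its parts off and on `S`. Weights multiply, and the inner boundary lies
in `X`, so the outer part must move `U` into `X`. Conversely the truncation never obstructs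
recombination: the outer boundary has at most `2 * D` variables, so the outer support has at most `4
* D` constraints, as does `S`. -/
theorem pexp_add {r s D : ℕ} (hΦ : Φ.Expands r) (hs : 8 * D ≤ s) (hr : s ≤ r) {X : Finset V}
    {S : Finset ι} (hcl : Φ.IsClosed s X S) (hS : S.card ≤ 4 * D) {A U : V → ZMod 2}
    (hA : fsupp A ⊆ X) (hU : (fsupp U).card ≤ D) :
    Φ.pexp s (A + U) =
      ∑ H ∈ Φ.outer s X S U, Φ.weight H * Φ.localExp S (A + (U + bdry H)) := by
  simp only [pexp, localExp, Finset.mul_sum]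
  rw [Finset.sum_sigma']
  refine Finset.sum_nbij' (fun H => ⟨restr Sᶜ H, restr S H⟩) (fun p => p.1 + p.2) ?_ ?_ ?_ ?_ ?_
  · intro H hH
    simp only [Finset.mem_filter, Finset.mem_univ, true_and] at hH
    obtain ⟨hw, hs, hb⟩ := hH
    have hdisj : Disjoint (supp (restr Sᶜ H)) (supp (restr S H)) := by
      rw [supp_restr, supp_restr]
      exact Finset.disjoint_of_subset_left Finset.inter_subset_right
        (Finset.disjoint_of_subset_right Finset.inter_subset_right disjoint_compl_left)
    have hmul := weight_add (Φ := Φ) hdisj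
    rw [restr_add_restr_compl] at hmul
    rw [hmul] at hw
    have hb' : bdry (restr S H) = A + (U + bdry (restr Sᶜ H)) := by
      have h1 : bdry (restr Sᶜ H) + bdry (restr S H) = A + U := by
        rw [← bdry_add, restr_add_restr_compl, hb]
      rw [← add_assoc, ← h1, add_comm (bdry (restr Sᶜ H)), add_assoc, add_self_eq_zero', add_zero]
    have hsub : supp (restr S H) ⊆ S := by rw [supp_restr]; exact Finset.inter_subset_right
    simp only [Finset.mem_sigma, outer, Finset.mem_filter, Finset.mem_univ, true_and]
    refine ⟨⟨left_ne_zero_of_mul hw, ?_, ?_, ?_⟩, right_ne_zero_of_mul hw, hsub, hb'⟩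
    · rw [supp_restr]
      exact Finset.disjoint_of_subset_left Finset.inter_subset_right disjoint_compl_left
    · rw [supp_restr]
      exact (Finset.card_le_card Finset.inter_subset_left).trans hs
    · have h1 : U + bdry (restr Sᶜ H) = A + bdry (restr S H) := by
        rw [hb', ← add_assoc, add_self_eq_zero', zero_add]
      rw [h1]
      exact (fsupp_add_subset _ _).trans (Finset.union_subset hA
        ((fsupp_bdry_subset (right_ne_zero_of_mul hw) hsub).trans hcl.nbr_subset))
  · rintro ⟨Ho, Hi⟩ hp
    simp only [Finset.mem_sigma, outer, Finset.mem_filter, Finset.mem_univ, true_and] at hp ⊢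
    obtain ⟨⟨h1, h2, h3, h4⟩, h5, h6, h7⟩ := hp
    refine ⟨?_, ?_, ?_⟩
    · rw [weight_add (Finset.disjoint_of_subset_right h6 h2)]
      exact mul_ne_zero h1 h5
    · have hc1 := card_supp_le hΦ h1 (h3.trans hr)
      have hc2 : (fsupp (bdry Ho)).card ≤ 2 * D := by
        have e1 := Finset.card_inter_add_card_sdiff (fsupp (bdry Ho)) X
        have e2 : (fsupp U \ X).card ≤ D := (Finset.card_le_card Finset.sdiff_subset).trans hU
        rcases (supp Ho).eq_empty_or_nonempty with he | hne
        · rw [supp_eq_empty_iff] at he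
          simp [he, bdry, fsupp]
        · have e3 := hcl.bdry_lt Ho h1 hne h2 h3
          rw [fsupp_bdry_sdiff h4] at e1 e3
          omega
      have hc3 := (Finset.card_le_card (supp_add_subset Ho Hi)).trans (Finset.card_union_le _ _)
      have hc4 := Finset.card_le_card h6
      omega
    · rw [bdry_add, h7, add_comm, add_assoc, add_assoc, add_self_eq_zero', add_zero]
  · intro H _
    exact restr_add_restr_compl S H
  · rintro ⟨Ho, Hi⟩ hp
    simp only [Finset.mem_sigma, outer, Finset.mem_filter, Finset.mem_univ, true_and] at hp
    obtain ⟨⟨-, h2, -, -⟩, -, h6, -⟩ := hp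
    have hi : ∀ c, c ∉ S → Hi c = 0 := fun c hc => by
      by_contra h
      exact hc (h6 (mem_supp.2 h))
    have ho : ∀ c, c ∈ S → Ho c = 0 := fun c hc => by
      by_contra h
      exact Finset.disjoint_left.1 h2 (mem_supp.2 h) hc
    refine Sigma.ext ?_ (heq_of_eq ?_)
    · funext c
      by_cases hc : c ∈ S
      · simp [restr, hc, ho c hc]
      · simp [restr, hc, hi c hc]
    · funext c
      by_cases hc : c ∈ S
      · simp [restr, hc, ho c hc]
      · simp [restr, hc, hi c hc]
  · intro H _
    rw [← weight_add, restr_add_restr_compl]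
    rw [supp_restr, supp_restr]
    exact Finset.disjoint_of_subset_left Finset.inter_subset_right
      (Finset.disjoint_of_subset_right Finset.inter_subset_right disjoint_compl_left)

end ConstraintSystem

/-! ### Positivity and single-clause moments. -/

/-- The projection of a vector to the span of some basis vectors, for a semi-inner product. -/
theorem exists_projection {α E : Type*} [Fintype α] [DecidableEq α] [NormedAddCommGroup E]
    [InnerProductSpace ℝ E] (L : (α → ℝ) →ₗ[ℝ] E) (F : Finset α) (w : α → ℝ) :
    ∃ q : α → ℝ, (∀ T, q T ≠ 0 → T ∈ F) ∧
      ∀ U ∈ F, inner ℝ (L (w - q)) (L (Pi.single U 1)) = 0 := by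
  let K : Submodule ℝ (α → ℝ) :=
    { carrier := {q | ∀ T, q T ≠ 0 → T ∈ F}
      zero_mem' := by intro T h; simp at h
      add_mem' := by
        intro a b ha hb T hT
        by_cases h : a T = 0
        · exact hb T fun h' => hT (by simp [h, h'])
        · exact ha T h
      smul_mem' := by
        intro c a ha T hT
        exact ha T fun h => hT (by simp [h]) }
  -- `L` need not be injective: project onto the image in `E` and choose a preimage.
  let M : Submodule ℝ E := K.map L
  obtain ⟨q, hq, hqe⟩ := (M.orthogonalProjectionOnto (L w)).2
  refine ⟨q, hq, fun U hU => ?_⟩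
  have hmem : L (Pi.single U 1) ∈ M := by
    refine ⟨Pi.single U 1, fun T hT => ?_, rfl⟩
    by_cases h : T = U
    · exact h ▸ hU
    · simp [h] at hT
  rw [map_sub, hqe]
  exact M.starProjection_inner_eq_zero (L w) _ hmem

namespace ConstraintSystem

variable {V ι : Type*} [Fintype V] [DecidableEq V] [Fintype ι] [DecidableEq ι] {k : ℕ}
variable (Φ : ConstraintSystem V ι k)

/-- The bilinear form of the pseudo-moments. -/
def pform (s : ℕ) : LinearMap.BilinForm ℝ ((V → ZMod 2) → ℝ) :=
  Matrix.toBilin' (Matrix.of fun A B => Φ.pexp s (A + B))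

theorem pform_apply (s : ℕ) (p q : (V → ZMod 2) → ℝ) :
    Φ.pform s p q = ∑ A, ∑ B, p A * Φ.pexp s (A + B) * q B := by
  simp [pform, Matrix.toBilin'_apply]

/-- A realization of the local moments as inner products. -/
def localVec (S : Finset ι) : ((V → ZMod 2) → ℝ) →ₗ[ℝ] EuclideanSpace ℝ (V → ℤˣ) where
  toFun p := WithLp.toLp 2 fun x =>
    √(Φ.density S x / 2 ^ Fintype.card V) * ∑ A, p A * chi A x
  map_add' p q := by
    ext x
    simp [add_mul, Finset.sum_add_distrib, mul_add]
  map_smul' a p := by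
    ext x
    simp only [Pi.smul_apply, smul_eq_mul, RingHom.id_apply, PiLp.smul_apply, mul_assoc,
      ← Finset.mul_sum]
    ring

theorem inner_localVec_single (S : Finset ι) (p : (V → ZMod 2) → ℝ) (U : V → ZMod 2) :
    inner ℝ (Φ.localVec S p) (Φ.localVec S (Pi.single U 1)) =
      ∑ A, p A * Φ.localExp S (A + U) := by
  simp only [PiLp.inner_apply, localVec, LinearMap.coe_mk, AddHom.coe_mk, localExp_eq_sum,
    Finset.mul_sum]
  rw [Finset.sum_comm]
  refine Finset.sum_congr rfl fun x _ => ?_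
  have h1 : ∑ A, (Pi.single U 1 : (V → ZMod 2) → ℝ) A * chi A x = chi U x := by
    simp [Pi.single_apply]
  have h2 : √(Φ.density S x / 2 ^ Fintype.card V) * √(Φ.density S x / 2 ^ Fintype.card V) =
      Φ.density S x / 2 ^ Fintype.card V :=
    Real.mul_self_sqrt (div_nonneg (Φ.density_nn S x) (by positivity))
  simp only [← Finset.mul_sum, h1, chi_add]
  generalize √(Φ.density S x / 2 ^ Fintype.card V) = a at h2 ⊢
  rw [← h2]
  simp only [RCLike.inner_apply, Finset.mul_sum, conj_trivial]
  refine Finset.sum_congr rfl fun A _ => ?_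
  ring

variable {Φ}

/-- Gram–Schmidt by degree, each character being projected locally in a closed pair around its
support. By `pexp_add`, pairing the remainder with an earlier `U` reduces to local pairings with
characters inside `X` that are `U` itself or strictly shorter; all are earlier, so these vanish. -/
theorem pform_self_nonneg {r s D : ℕ} (hΦ : Φ.Expands r) (hs : 8 * D ≤ s) (hr : 4 * D + s ≤ r)
    (p : (V → ZMod 2) → ℝ) (hp : ∀ A, p A ≠ 0 → (fsupp A).card ≤ D) : 0 ≤ Φ.pform s p p := by
  refine nonneg_of_gramSchmidt (Φ.pform s) ?_ (fun A => (fsupp A).card) D ?_ p hp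
  · intro p q
    rw [pform_apply, pform_apply, Finset.sum_comm]
    refine Finset.sum_congr rfl fun A _ => Finset.sum_congr rfl fun B _ => ?_
    rw [add_comm A B]; ring
  intro A hA F hAF hF hF'
  obtain ⟨X, S, hAX, hS, hcl⟩ := exists_isClosed (s := s) hΦ hr (fsupp A) hA
  obtain ⟨q, hq, horth⟩ := exists_projection (Φ.localVec S) (F.filter fun T => fsupp T ⊆ X)
    (Pi.single A 1)
  set z : (V → ZMod 2) → ℝ := Pi.single A 1 - q with hz
  have hzX : ∀ T, z T ≠ 0 → fsupp T ⊆ X := by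
    intro T hT
    by_cases h : T = A
    · exact h ▸ hAX
    · refine (Finset.mem_filter.1 (hq T fun h' => hT ?_)).2
      simp [hz, h, h']
  have hzD : ∀ T, z T ≠ 0 → (fsupp T).card ≤ D := by
    intro T hT
    by_cases h : T = A
    · exact h ▸ hA
    · refine (hF T (Finset.mem_filter.1 (hq T fun h' => hT ?_)).1).trans hA
      simp [hz, h, h']
  have hform : ∀ U, (fsupp U).card ≤ D → Φ.pform s z (Pi.single U 1) =
      ∑ H ∈ Φ.outer s X S U, Φ.weight H *
        inner ℝ (Φ.localVec S z) (Φ.localVec S (Pi.single (U + bdry H) 1)) := by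
    intro U hU
    have h1 : Φ.pform s z (Pi.single U 1) = ∑ T, z T * Φ.pexp s (T + U) := by
      rw [pform_apply]
      simp [Pi.single_apply]
    rw [h1]
    simp only [inner_localVec_single, Finset.mul_sum]
    rw [Finset.sum_comm]
    refine Finset.sum_congr rfl fun T _ => ?_
    by_cases hT : z T = 0
    · simp [hT]
    · rw [pexp_add hΦ hs (by omega) hcl hS (hzX T hT) hU, Finset.mul_sum]
      refine Finset.sum_congr rfl fun H _ => ?_
      ring
  refine ⟨q, fun T hT => (Finset.mem_filter.1 (hq T hT)).1, fun U hU => ?_, ?_⟩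
  · rw [hform U ((hF U hU).trans hA)]
    refine Finset.sum_eq_zero fun H hH => ?_
    have hHX : fsupp (U + bdry H) ⊆ X := by
      simp only [outer, Finset.mem_filter] at hH
      exact hH.2.2.2.2
    rw [horth _ (Finset.mem_filter.2 ⟨?_, hHX⟩), mul_zero]
    rcases (supp H).eq_empty_or_nonempty with he | hne
    · rw [supp_eq_empty_iff] at he
      simpa [he, bdry] using hU
    · exact hF' _ ((card_fsupp_lt hcl hH hne).trans_le (hF U hU))
  -- On characters inside `X` only the zero outer selection survives, so the global form is the
  -- local inner product.
  · have hloc : Φ.pform s z z = inner ℝ (Φ.localVec S z) (Φ.localVec S z) := by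
      have hlin : ∀ f : ((V → ZMod 2) → ℝ) →ₗ[ℝ] ℝ, f z = ∑ U, z U * f (Pi.single U 1) := by
        intro f
        have hsum : z = ∑ U, z U • (Pi.single U (1 : ℝ) : (V → ZMod 2) → ℝ) := by
          funext T
          simp [Finset.sum_apply, Pi.single_apply]
        conv_lhs => rw [hsum, map_sum]
        simp
      have h1 := hlin (Φ.pform s z)
      have h2 := hlin ((innerₛₗ ℝ (Φ.localVec S z)) ∘ₗ Φ.localVec S)
      simp only [LinearMap.comp_apply, innerₛₗ_apply_apply] at h2
      rw [h1, h2]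
      refine Finset.sum_congr rfl fun U _ => ?_
      by_cases hU : z U = 0
      · simp [hU]
      · rw [hform U (hzD U hU), outer_eq_singleton hcl (hzX U hU)]
        simp [bdry, weight, Φ.coef_zero]
    rw [hloc]
    exact real_inner_self_nonneg

/-- After its component at `c` is removed, a contributing selection still has boundary among the
variables of `c`, hence is zero by `supp_eq_empty_of_bdry_subset_nbr`. -/
theorem pexp_eq_coef {r s : ℕ} (hΦ : Φ.Expands (r + 1)) (hs : 1 ≤ s) (hr : s ≤ r) (c : ι)
    {A : V → ZMod 2} (hA : fsupp A ⊆ Φ.nbr c) : Φ.pexp s A = Φ.coef c A := by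
  have hw : Φ.weight (Pi.single c A) = Φ.coef c A := by
    rw [weight, Finset.prod_eq_single c]
    · simp
    · intro b _ hb
      simp [hb, Φ.coef_zero]
    · simp
  have hb : bdry (Pi.single c A : ι → V → ZMod 2) = A := by
    rw [bdry, Finset.sum_eq_single c]
    · simp
    · intro b _ hb
      simp [hb]
    · simp
  have hsupp : (supp (Pi.single c A : ι → V → ZMod 2)) ⊆ {c} := by
    intro b hb
    by_contra h
    rw [mem_supp, Pi.single_eq_of_ne (by simpa using h)] at hb
    exact hb rfl
  rw [pexp, ← hw]
  refine Finset.sum_eq_single _ (fun H hH hne => absurd ?_ hne) fun h => ?_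
  · simp only [Finset.mem_filter, Finset.mem_univ, true_and] at hH
    obtain ⟨hHw, hHs, hHb⟩ := hH
    have hdisj : Disjoint (supp (restr {c}ᶜ H)) (supp (restr {c} H)) := by
      rw [supp_restr, supp_restr]
      exact Finset.disjoint_of_subset_left Finset.inter_subset_right
        (Finset.disjoint_of_subset_right Finset.inter_subset_right disjoint_compl_left)
    have hmul := weight_add (Φ := Φ) hdisj
    rw [restr_add_restr_compl] at hmul
    rw [hmul] at hHw
    have hsub : fsupp (bdry (restr {c} H)) ⊆ Φ.nbr c := by
      have h1 : supp (restr {c} H) ⊆ {c} := by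
        rw [supp_restr]; exact Finset.inter_subset_right
      simpa [nbrs] using fsupp_bdry_subset (right_ne_zero_of_mul hHw) h1
    have hb1 : bdry (restr {c}ᶜ H) = A + bdry (restr {c} H) := by
      have h1 : bdry (restr {c}ᶜ H) + bdry (restr {c} H) = A := by
        rw [← bdry_add, restr_add_restr_compl, hHb]
      rw [← h1, add_assoc, add_self_eq_zero', add_zero]
    have hempty := supp_eq_empty_of_bdry_subset_nbr hΦ (left_ne_zero_of_mul hHw)
      (((Finset.card_le_card (by rw [supp_restr]; exact Finset.inter_subset_left)).trans hHs).trans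
        hr) c (by simp [restr])
      (hb1 ▸ (fsupp_add_subset _ _).trans (Finset.union_subset hA hsub))
    rw [supp_eq_empty_iff] at hempty
    have hH : H = Pi.single c (H c) := by
      conv_lhs => rw [← restr_add_restr_compl {c} H, hempty, zero_add]
      funext b
      by_cases h : b = c
      · subst h; simp [restr]
      · simp [restr, h]
    have hHc : H c = A := by
      rw [← hHb, hH]
      simp [bdry]
    rw [← hHc]
    exact hH
  · by_contra hne
    refine h (Finset.mem_filter.2 ⟨Finset.mem_univ _, hne, ?_, hb⟩)
    exact (Finset.card_le_card hsupp).trans (by simpa using hs)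

theorem pexp_zero {r s : ℕ} (hΦ : Φ.Expands r) (hr : s ≤ r) : Φ.pexp s 0 = 1 := by
  have hw : Φ.weight 0 = 1 := by simp [weight, Φ.coef_zero]
  rw [pexp, ← hw]
  refine Finset.sum_eq_single _ (fun H hH hne => absurd ?_ hne) fun h => ?_
  · simp only [Finset.mem_filter, Finset.mem_univ, true_and] at hH
    obtain ⟨hHw, hHs, hHb⟩ := hH
    have h1 := card_supp_le hΦ hHw (hHs.trans hr)
    rw [hHb] at h1
    rw [← supp_eq_empty_iff, ← Finset.card_eq_zero]
    simpa [fsupp] using h1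
  · exact absurd (Finset.mem_filter.2 ⟨Finset.mem_univ _, by simp [hw], by simp [supp],
      by simp [bdry]⟩) h

end ConstraintSystem

/-! ### Expectations and pairwise independence. -/

section Expect

theorem PMF_sum_toReal {α : Type*} [Fintype α] (μ : PMF α) : ∑ a, (μ a).toReal = 1 := by
  have h := μ.tsum_coe
  rw [tsum_fintype] at h
  rw [← ENNReal.toReal_sum fun a _ => μ.apply_ne_top a, h, ENNReal.toReal_one]

theorem expect_map {α β : Type*} [Fintype α] [Fintype β] (μ : PMF α) (f : α → β) (g : β → ℝ) :
    expect (μ.map f) g = expect μ fun a => g (f a) := by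
  classical
  have h : ∀ b, ((μ.map f) b).toReal = ∑ a, if b = f a then (μ a).toReal else 0 := by
    intro b
    rw [PMF.map_apply, tsum_fintype, ENNReal.toReal_sum]
    · exact Finset.sum_congr rfl fun a _ => by split_ifs <;> simp
    · intro a _
      split_ifs
      · exact μ.apply_ne_top a
      · simp
  simp only [expect, h, Finset.sum_mul]
  rw [Finset.sum_comm]
  simp [ite_mul]

/-- The one use of pairwise independence; it yields `three_le_card`. The factors `a j` absorb the
signs of the literals. -/
theorem IsPairwiseIndependent.expect_prod_eq_zero {k : ℕ} {μ : PMF (Fin k → ℤˣ)}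
    (hμ : IsPairwiseIndependent μ) {T : Finset (Fin k)} (hT : T.Nonempty) (hT' : T.card < 3)
    (a : Fin k → ℝ) : expect μ (fun y => ∏ j ∈ T, a j * signReal (y j)) = 0 := by
  have hu : (Finset.univ : Finset ℤˣ) = {1, -1} := rfl
  have hpos := hT.card_pos
  have hcases : T.card = 1 ∨ T.card = 2 := by omega
  rcases hcases with h | h
  · obtain ⟨i, rfl⟩ := Finset.card_eq_one.1 h
    have := expect_map μ (fun y => y i) fun u => a i * signReal u
    rw [hμ.coord i] at this
    simp only [Finset.prod_singleton]
    rw [← this]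
    simp [expect, hu, signReal]
  · obtain ⟨i, j, hij, rfl⟩ := Finset.card_eq_two.1 h
    have := expect_map μ (fun y => (y i, y j)) fun u => (a i * signReal u.1) * (a j * signReal u.2)
    rw [hμ.pair i j hij] at this
    simp only [Finset.prod_pair hij]
    rw [← this]
    simp [expect, Fintype.sum_prod_type, hu, signReal]

end Expect

/-! ### Clauses as constraint systems. -/

section ClauseSystem

variable {k n : ℕ}

/-- The indicator vector of a finite set. -/
def indVec {V : Type*} [DecidableEq V] (T : Finset V) : V → ZMod 2 :=
  fun v => if v ∈ T then 1 else 0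

theorem indVec_injective {V : Type*} [DecidableEq V] :
    Function.Injective (indVec : Finset V → V → ZMod 2) := by
  intro S T h
  ext v
  have := congrFun h v
  by_cases h1 : v ∈ S <;> by_cases h2 : v ∈ T <;> simp_all [indVec]

theorem fsupp_indVec {V : Type*} [Fintype V] [DecidableEq V] (T : Finset V) :
    fsupp (indVec T) = T := by
  ext v
  simp [mem_fsupp, indVec]

theorem indVec_eq_zero {V : Type*} [DecidableEq V] {T : Finset V} : indVec T = 0 ↔ T = ∅ := by
  have h : indVec (∅ : Finset V) = 0 := by funext v; simp [indVec]
  rw [← h, indVec_injective.eq_iff]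

/-- The variables of a clause. -/
def Clause.vars (C : Clause k n) (j : Fin k) : Fin n := (C j).var

/-- The moment of the literals in `T` under the distribution `μ` of the values of the literals
of `C`. -/
def Clause.moment (C : Clause k n) (μ : PMF (Fin k → ℤˣ)) (T : Finset (Fin k)) : ℝ :=
  expect μ fun y => ∏ j ∈ T, signReal (C j).sign * signReal (y j)

/-- The Fourier coefficients of the density of `μ` on the variables of `C`. -/
def Clause.coef (C : Clause k n) (μ : PMF (Fin k → ℤˣ)) (A : Fin n → ZMod 2) : ℝ :=
  ∑ T : Finset (Fin k), if A = indVec (T.image C.vars) then C.moment μ T else 0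

theorem Clause.coef_indVec {C : Clause k n} (hC : Function.Injective C.vars)
    (μ : PMF (Fin k → ℤˣ)) (T : Finset (Fin k)) :
    C.coef μ (indVec (T.image C.vars)) = C.moment μ T := by
  rw [Clause.coef, Finset.sum_eq_single T]
  · simp
  · intro S _ hS
    rw [if_neg]
    intro h
    exact hS (Finset.image_injective hC (indVec_injective h)).symm
  · simp

theorem Clause.exists_of_coef_ne_zero {C : Clause k n} {μ : PMF (Fin k → ℤˣ)}
    {A : Fin n → ZMod 2} (h : C.coef μ A ≠ 0) :
    ∃ T : Finset (Fin k), A = indVec (T.image C.vars) ∧ C.moment μ T ≠ 0 := by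
  obtain ⟨T, -, hT⟩ := Finset.exists_ne_zero_of_sum_ne_zero h
  by_cases hA : A = indVec (T.image C.vars)
  · exact ⟨T, hA, by simpa [hA] using hT⟩
  · simp [hA] at hT

theorem chi_indVec {V : Type*} [Fintype V] [DecidableEq V] (T : Finset V) (x : V → ℤˣ) :
    chi (indVec T) x = ∏ v ∈ T, signReal (x v) := by
  rw [chi, ← Finset.prod_subset (Finset.subset_univ T)]
  · exact Finset.prod_congr rfl fun v hv => by simp [indVec, hv]
  · intro v _ hv
    simp [indVec, hv]

/-- Writes the density as an average of products whose factors are `0` or `2`, so that its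
nonnegativity is visible. -/
theorem Clause.sum_coef_mul_chi {C : Clause k n} (hC : Function.Injective C.vars)
    (μ : PMF (Fin k → ℤˣ)) (x : Fin n → ℤˣ) :
    ∑ A, C.coef μ A * chi A x = expect μ fun y =>
      ∏ j, (1 + signReal (C j).sign * signReal (y j) * signReal (x (C.vars j))) := by
  have h1 : ∑ A, C.coef μ A * chi A x =
      ∑ T : Finset (Fin k), C.moment μ T * ∏ j ∈ T, signReal (x (C.vars j)) := by
    simp only [Clause.coef, Finset.sum_mul]
    rw [Finset.sum_comm]
    refine Finset.sum_congr rfl fun T _ => ?_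
    rw [Finset.sum_eq_single (indVec (T.image C.vars))]
    · rw [if_pos rfl, chi_indVec, Finset.prod_image fun a _ b _ h => hC h]
    · intro A _ hA
      simp [hA]
    · simp
  rw [h1]
  simp only [expect, Clause.moment, Finset.prod_one_add, Finset.sum_mul, Finset.powerset_univ,
    Finset.mul_sum]
  rw [Finset.sum_comm]
  simp only [Finset.prod_mul_distrib, mul_assoc]

theorem expect_nonneg {α : Type*} [Fintype α] (μ : PMF α) {f : α → ℝ} (hf : ∀ a, 0 ≤ f a) :
    0 ≤ expect μ f :=
  Finset.sum_nonneg fun a _ => mul_nonneg ENNReal.toReal_nonneg (hf a)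

/-- The constraint system of a family of clauses under a pairwise independent distribution. -/
def clauseSystem {ι : Type*} (Cl : ι → Clause k n) (hCl : ∀ c, Function.Injective (Cl c).vars)
    {μ : PMF (Fin k → ℤˣ)} (hμ : IsPairwiseIndependent μ) : ConstraintSystem (Fin n) ι k where
  nbr c := Finset.univ.image (Cl c).vars
  card_nbr c := by rw [Finset.card_image_of_injective _ (hCl c)]; simp
  coef c := (Cl c).coef μ
  coef_zero c := by
    have h := Clause.coef_indVec (hCl c) μ ∅
    rw [Finset.image_empty, indVec_eq_zero.2 rfl] at h
    rw [h]
    simp [Clause.moment, expect, PMF_sum_toReal]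
  three_le_card c A hA hA0 := by
    obtain ⟨T, rfl, hT⟩ := Clause.exists_of_coef_ne_zero hA
    rw [fsupp_indVec, Finset.card_image_of_injective _ (hCl c)]
    by_contra! hlt
    refine hT (hμ.expect_prod_eq_zero (Finset.nonempty_iff_ne_empty.2 ?_) hlt _)
    rintro rfl
    exact hA0 (indVec_eq_zero.2 (Finset.image_empty _))
  fsupp_subset c A hA := by
    obtain ⟨T, rfl, hT⟩ := Clause.exists_of_coef_ne_zero hA
    rw [fsupp_indVec]
    exact Finset.image_subset_image (Finset.subset_univ T)
  density_nonneg c x := by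
    have h := Clause.sum_coef_mul_chi (hCl c) μ x
    have h0 : 0 ≤ expect μ fun y => ∏ j,
        (1 + signReal ((Cl c) j).sign * signReal (y j) * signReal (x ((Cl c).vars j))) := by
      refine expect_nonneg μ fun y => Finset.prod_nonneg fun j _ => ?_
      rcases Int.units_eq_one_or ((Cl c) j).sign with h1 | h1 <;>
        rcases Int.units_eq_one_or (y j) with h2 | h2 <;>
        rcases Int.units_eq_one_or (x ((Cl c).vars j)) with h3 | h3 <;>
        simp [signReal, h1, h2, h3]
    convert h0 using 1
    rw [← h]
    congr!

end ClauseSystem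

/-! ### The pseudo-expectation operator on polynomials. -/

section Operator

open MvPolynomial

variable {n k : ℕ} {ι : Type*} [Fintype ι] [DecidableEq ι]

/-- The parities of the exponents of a monomial. -/
def parity (m : Fin n →₀ ℕ) : Fin n → ZMod 2 := fun v => (m v : ZMod 2)

theorem parity_add (m m' : Fin n →₀ ℕ) : parity (m + m') = parity m + parity m' := by
  funext v
  simp [parity]

/-- The reduction of a polynomial modulo the relations `X_v ^ 2 = 1`. -/
def toVec (n : ℕ) : MvPolynomial (Fin n) ℝ →ₗ[ℝ] ((Fin n → ZMod 2) → ℝ) :=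
  (basisMonomials (Fin n) ℝ).constr ℝ fun m => Pi.single (parity m) 1

theorem toVec_monomial (m : Fin n →₀ ℕ) (a : ℝ) :
    toVec n (monomial m a) = a • Pi.single (parity m) 1 := by
  have h : monomial m a = a • basisMonomials (Fin n) ℝ m := by simp [smul_monomial]
  rw [h, map_smul, toVec, Module.Basis.constr_basis]

/-- The linear functional on polynomials with the pseudo-moments of `Φ`. -/
def pseudoOp (Φ : ConstraintSystem (Fin n) ι k) (s : ℕ) : MvPolynomial (Fin n) ℝ →ₗ[ℝ] ℝ :=
  (basisMonomials (Fin n) ℝ).constr ℝ fun m => Φ.pexp s (parity m)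

variable (Φ : ConstraintSystem (Fin n) ι k) (s : ℕ)

theorem pseudoOp_monomial (m : Fin n →₀ ℕ) (a : ℝ) :
    pseudoOp Φ s (monomial m a) = a * Φ.pexp s (parity m) := by
  have h : monomial m a = a • basisMonomials (Fin n) ℝ m := by simp [smul_monomial]
  rw [h, map_smul, pseudoOp, Module.Basis.constr_basis, smul_eq_mul]

/-- Exponent parities add under multiplication, so the operator factors through the moment matrix on
characters. -/
theorem pseudoOp_mul (p q : MvPolynomial (Fin n) ℝ) :
    pseudoOp Φ s (p * q) = Φ.pform s (toVec n p) (toVec n q) := by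
  induction p using MvPolynomial.induction_on' with
  | add p p' h h' => simp [add_mul, h, h']
  | monomial m a =>
    induction q using MvPolynomial.induction_on' with
    | add q q' h h' => simp [mul_add, h, h']
    | monomial m' a' =>
      rw [monomial_mul, pseudoOp_monomial, toVec_monomial, toVec_monomial, parity_add, map_smul,
        map_smul, LinearMap.smul_apply, ConstraintSystem.pform_apply]
      simp [Pi.single_apply, mul_assoc]
      ring

theorem card_fsupp_of_toVec_ne_zero {D : ℕ} {p : MvPolynomial (Fin n) ℝ} (hp : p ∈ PolyLE n D)
    {A : Fin n → ZMod 2} (hA : toVec n p A ≠ 0) : (fsupp A).card ≤ D := by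
  rw [p.as_sum, map_sum, Finset.sum_apply] at hA
  obtain ⟨m, hm, hmA⟩ := Finset.exists_ne_zero_of_sum_ne_zero hA
  rw [toVec_monomial] at hmA
  have hAm : A = parity m := by
    by_contra h
    simp [h] at hmA
  have h1 := (le_totalDegree hm).trans ((mem_restrictTotalDegree _ _ _).1 hp)
  refine le_trans ?_ h1
  rw [hAm, Finsupp.sum]
  have hsub : fsupp (parity m) ⊆ m.support := by
    intro v hv
    rw [mem_fsupp] at hv
    rw [Finsupp.mem_support_iff]
    intro h0
    exact hv (by simp [parity, h0])
  refine (Finset.card_le_card hsub).trans ?_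
  rw [Finset.card_eq_sum_ones]
  exact Finset.sum_le_sum fun v hv => Nat.one_le_iff_ne_zero.2 (Finsupp.mem_support_iff.1 hv)

/-- With `pseudoOp_mul` this gives the Boolean constraints against every multiplier. -/
theorem toVec_sq_sub_one (j : Fin n) : toVec n (X j ^ 2 - 1) = 0 := by
  have h0 : parity (Finsupp.single j 2 : Fin n →₀ ℕ) = parity 0 := by
    funext v
    have : (2 : ZMod 2) = 0 := by decide
    by_cases h : j = v
    · subst h; simp [parity, this]
    · simp [parity, h]
  have h1 : (1 : MvPolynomial (Fin n) ℝ) = monomial 0 1 := rfl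
  rw [map_sub, X_pow_eq_monomial, h1, toVec_monomial, toVec_monomial, h0, sub_self]

theorem parity_sum_single {T : Finset (Fin k)} {v : Fin k → Fin n} (hv : Function.Injective v) :
    parity (∑ j ∈ T, Finsupp.single (v j) 1) = indVec (T.image v) := by
  funext u
  rw [parity, Finsupp.finsetSum_apply, Nat.cast_sum]
  rw [← Finset.sum_image (f := fun w => (((Finsupp.single w 1 : Fin n →₀ ℕ) u : ℕ) : ZMod 2))
    fun a _ b _ h => hv h]
  simp [indVec, Finsupp.single_apply]

theorem half_prod_eq (y y' : Fin k → ℤˣ) :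
    ∏ j, (1 / 2 : ℝ) * (1 + signReal (y j) * signReal (y' j)) = if y = y' then 1 else 0 := by
  have h1 : ∀ a b : ℤˣ, (1 / 2 : ℝ) * (1 + signReal a * signReal b) = if a = b then 1 else 0 := by
    intro a b
    rcases Int.units_eq_one_or a with rfl | rfl <;> rcases Int.units_eq_one_or b with rfl | rfl <;>
      norm_num [signReal]
  simp only [h1]
  split_ifs with h
  · subst h
    simp
  · obtain ⟨j, hj⟩ := Function.ne_iff.1 h
    exact Finset.prod_eq_zero (Finset.mem_univ j) (if_neg hj)

/-- By linearity `f` is the indicator of a point `y`. Its polynomial expands into characters on one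
clause, whose moments are those of `μ`, and Fourier inversion (`half_prod_eq`) returns the
probability of `y`. -/
theorem pseudoOp_clause_poly (Cl : ι → Clause k n) (hCl : ∀ c, Function.Injective (Cl c).vars)
    {μ : PMF (Fin k → ℤˣ)} (hμ : IsPairwiseIndependent μ) {r s : ℕ}
    (hΦ : (clauseSystem Cl hCl hμ).Expands (r + 1)) (hs : 1 ≤ s) (hr : s ≤ r) (c : ι)
    (f : (Fin k → ℤˣ) → ℝ) :
    pseudoOp (clauseSystem Cl hCl hμ) s ((Cl c).poly f) = expect μ f := by
  set Φ := clauseSystem Cl hCl hμ with hΦd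
  have hmono : ∀ T : Finset (Fin k), ∀ a : ℝ,
      pseudoOp Φ s (C a * ∏ j ∈ T, X ((Cl c).vars j)) = a * (Cl c).moment μ T := by
    intro T a
    have h1 : ∏ j ∈ T, (X ((Cl c).vars j) : MvPolynomial (Fin n) ℝ) =
        monomial (∑ j ∈ T, Finsupp.single ((Cl c).vars j) 1) 1 := by
      rw [monomial_sum_one]
      rfl
    rw [h1, C_mul_monomial, mul_one, pseudoOp_monomial, parity_sum_single (hCl c),
      ← Clause.coef_indVec (hCl c)]
    congr 1
    refine ConstraintSystem.pexp_eq_coef hΦ hs hr c ?_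
    rw [fsupp_indVec]
    exact Finset.image_subset_image (Finset.subset_univ T)
  have hy : ∀ y : Fin k → ℤˣ, pseudoOp Φ s (∏ j, (C (1 / 2) *
      (1 + C (signReal (y j)) * ((Cl c) j).poly))) = (μ y).toReal := by
    intro y
    have h1 : (∏ j, (C (1 / 2) * (1 + C (signReal (y j)) * ((Cl c) j).poly)) :
        MvPolynomial (Fin n) ℝ) = ∑ T : Finset (Fin k), C ((∏ _j : Fin k, (1 / 2 : ℝ)) *
          ∏ j ∈ T, signReal (y j) * signReal ((Cl c) j).sign) * ∏ j ∈ T, X ((Cl c).vars j) := by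
      rw [Finset.prod_mul_distrib, Finset.prod_one_add, Finset.powerset_univ, Finset.mul_sum]
      refine Finset.sum_congr rfl fun T _ => ?_
      rw [C_mul, map_prod, map_prod, mul_assoc, ← Finset.prod_mul_distrib]
      congr 1
      refine Finset.prod_congr rfl fun j _ => ?_
      rw [C_mul, mul_assoc]
      rfl
    rw [h1, map_sum]
    simp only [hmono, Clause.moment, expect, Finset.mul_sum]
    rw [Finset.sum_comm]
    have h2 : ∀ y' : Fin k → ℤˣ, ∑ T : Finset (Fin k), ((∏ _j : Fin k, (1 / 2 : ℝ)) *
        ∏ j ∈ T, signReal (y j) * signReal ((Cl c) j).sign) *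
          ((μ y').toReal * ∏ j ∈ T, signReal ((Cl c) j).sign * signReal (y' j)) =
        (μ y').toReal * if y = y' then 1 else 0 := by
      intro y'
      rw [← half_prod_eq, Finset.prod_mul_distrib, Finset.prod_one_add, Finset.powerset_univ,
        Finset.mul_sum, Finset.mul_sum]
      refine Finset.sum_congr rfl fun T _ => ?_
      have h3 : (∏ j ∈ T, signReal (y j) * signReal ((Cl c) j).sign) *
          ∏ j ∈ T, signReal ((Cl c) j).sign * signReal (y' j) =
          ∏ j ∈ T, signReal (y j) * signReal (y' j) := by
        rw [← Finset.prod_mul_distrib]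
        refine Finset.prod_congr rfl fun j _ => ?_
        have := signReal_mul_self ((Cl c) j).sign
        linear_combination signReal (y j) * signReal (y' j) * this
      rw [← h3]
      ring
    simp only [h2]
    simp
  rw [Clause.poly, map_sum, expect]
  refine Finset.sum_congr rfl fun y _ => ?_
  rw [C_mul', map_smul, hy, smul_eq_mul, mul_comm]

/-- The pseudo-expectation of an expanding family of clauses. -/
theorem exists_pseudoExpectation (Cl : ι → Clause k n)
    (hCl : ∀ c, Function.Injective (Cl c).vars) {μ : PMF (Fin k → ℤˣ)}
    (hμ : IsPairwiseIndependent μ) {d : ℕ} (hd : 2 ≤ d) (hk : k ≤ d)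
    (hΦ : (clauseSystem Cl hCl hμ).Expands (12 * d)) :
    ∃ E : PolyLE n d →ₗ[ℝ] ℝ, IsPseudoExpectation E ∧
      (∀ j : Fin n, Satisfies E (X j ^ 2 - 1)) ∧
      ∀ c, ∀ f : (Fin k → ℤˣ) → ℝ, ∃ h : (Cl c).poly f ∈ PolyLE n d,
        E ⟨(Cl c).poly f, h⟩ = expect μ f := by
  -- Truncation at `8 * d` plus at most `4 * d` constraints in a closed pair account for the
  -- expansion range `12 * d`.
  refine ⟨(pseudoOp (clauseSystem Cl hCl hμ) (8 * d)).comp (PolyLE n d).subtype, ⟨?_, ?_⟩, ?_, ?_⟩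
  · have h1 : (1 : MvPolynomial (Fin n) ℝ) = monomial 0 1 := rfl
    have h2 : parity (0 : Fin n →₀ ℕ) = 0 := by funext v; simp [parity]
    simp only [LinearMap.comp_apply, Submodule.subtype_apply]
    rw [h1, pseudoOp_monomial, h2, ConstraintSystem.pexp_zero hΦ (by omega), mul_one]
  · intro p hp
    simp only [LinearMap.comp_apply, Submodule.subtype_apply]
    rw [sq, pseudoOp_mul]
    exact ConstraintSystem.pform_self_nonneg (D := d) hΦ le_rfl (by omega) _ fun A hA =>
      (card_fsupp_of_toVec_ne_zero hp hA).trans (Nat.div_le_self d 2)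
  · intro j
    refine ⟨?_, fun q hq => ?_⟩
    · refine Submodule.sub_mem _ ?_ (one_mem_polyLE n d)
      rw [mem_restrictTotalDegree, totalDegree_X_pow]
      exact hd
    · simp only [LinearMap.comp_apply, Submodule.subtype_apply]
      rw [pseudoOp_mul, toVec_sq_sub_one, map_zero, LinearMap.zero_apply]
  · intro c f
    refine ⟨(mem_restrictTotalDegree _ _ _).2
      (((mem_restrictTotalDegree _ _ _).1 (Clause.poly_mem _ f)).trans hk), ?_⟩
    simp only [LinearMap.comp_apply, Submodule.subtype_apply]
    have hr : 12 * d = (12 * d - 1) + 1 := by omega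
    rw [hr] at hΦ
    exact pseudoOp_clause_poly Cl hCl hμ hΦ (by omega) (by omega) c f

end Operator

/-! ### Concentration of the clause values under random signs. -/

section Chernoff

variable {ι Y : Type*} [Fintype ι] [DecidableEq ι] [Fintype Y] [DecidableEq Y]

/-- The statistical distance between the empirical distribution of `z` and the uniform one. -/
def deviation (z : ι → Y) : ℝ :=
  (1 / 2) * ∑ y, |(Finset.univ.filter fun c => z c = y).card / (Fintype.card ι : ℝ) -
    1 / (Fintype.card Y : ℝ)|

/-- The centered and scaled test function given by a choice of signs. -/
def signTest (s : Y → ℤˣ) (y : Y) : ℝ :=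
  (signReal (s y) - (∑ y', signReal (s y')) / Fintype.card Y) / 2

theorem abs_signReal (u : ℤˣ) : |signReal u| = 1 := by
  rcases Int.units_eq_one_or u with rfl | rfl <;> simp [signReal]

theorem sum_signTest [Nonempty Y] (s : Y → ℤˣ) : ∑ y, signTest s y = 0 := by
  simp only [signTest]
  rw [← Finset.sum_div, Finset.sum_sub_distrib, Finset.sum_const, Finset.card_univ, nsmul_eq_mul,
    mul_div_cancel₀ _ (by positivity), sub_self, zero_div]

theorem abs_signTest_le [Nonempty Y] (s : Y → ℤˣ) (y : Y) : |signTest s y| ≤ 1 := by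
  have h1 : |(∑ y', signReal (s y')) / (Fintype.card Y : ℝ)| ≤ 1 := by
    rw [abs_div, Nat.abs_cast, div_le_one (by positivity)]
    refine (Finset.abs_sum_le_sum_abs _ _).trans ?_
    simp [abs_signReal]
  rw [signTest, abs_div, abs_two, div_le_one two_pos]
  refine (abs_sub _ _).trans ?_
  rw [abs_signReal]
  linarith

/-- Test with the signs of the differences between empirical and uniform frequencies; the centering
in `signTest` supplies the uniform term. -/
theorem exists_signTest [Nonempty ι] [Nonempty Y] (z : ι → Y) :
    ∃ s : Y → ℤˣ, ∑ c, signTest s (z c) = Fintype.card ι * deviation z := by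
  set a : Y → ℝ := fun y => (Finset.univ.filter fun c => z c = y).card / (Fintype.card ι : ℝ) -
    1 / (Fintype.card Y : ℝ) with ha
  refine ⟨fun y => if 0 ≤ a y then 1 else -1, ?_⟩
  set s : Y → ℤˣ := fun y => if 0 ≤ a y then 1 else -1 with hs
  have h1 : ∀ y, |a y| = signReal (s y) * a y := by
    intro y
    by_cases h : 0 ≤ a y
    · simp [hs, h, signReal, abs_of_nonneg h]
    · simp [hs, h, signReal, abs_of_neg (not_le.1 h)]
  have h2 : ∑ c, signReal (s (z c)) =
      ∑ y, ((Finset.univ.filter fun c => z c = y).card : ℝ) * signReal (s y) := by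
    rw [← Finset.sum_fiberwise (s := Finset.univ) (g := z)]
    refine Finset.sum_congr rfl fun y _ => ?_
    rw [Finset.sum_congr rfl (g := fun _ => signReal (s y))
      fun c hc => by rw [(Finset.mem_filter.1 hc).2]]
    simp
  have hι : (Fintype.card ι : ℝ) ≠ 0 := by positivity
  have hY : (Fintype.card Y : ℝ) ≠ 0 := by positivity
  have hdev : deviation z = (1 / 2) * ∑ y, signReal (s y) * a y := by
    rw [deviation]
    exact congrArg _ (Finset.sum_congr rfl fun y _ => h1 y)
  rw [hdev]
  simp only [signTest]
  rw [← Finset.sum_div, Finset.sum_sub_distrib, Finset.sum_const, Finset.card_univ, nsmul_eq_mul,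
    h2]
  simp only [ha, mul_sub, Finset.sum_sub_distrib]
  rw [← Finset.sum_mul]
  have h3 : ∑ y, signReal (s y) * (((Finset.univ.filter fun c => z c = y).card : ℝ) /
      Fintype.card ι) = (∑ y, ((Finset.univ.filter fun c => z c = y).card : ℝ) * signReal (s y)) /
        Fintype.card ι := by
    rw [Finset.sum_div]
    exact Finset.sum_congr rfl fun y _ => by ring
  rw [h3]
  field_simp

/-- Bound `exp u` by `1 + u + u ^ 2` for `|u| ≤ 1`; centering kills the linear term. -/
theorem sum_exp_signTest_le [Nonempty Y] (s : Y → ℤˣ) {t : ℝ} (ht0 : 0 ≤ t) (ht : t ≤ 1) :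
    ∑ y, Real.exp (t * signTest s y) ≤ Fintype.card Y * Real.exp (t ^ 2) := by
  have h1 : ∀ y, Real.exp (t * signTest s y) ≤ 1 + t * signTest s y + t ^ 2 := by
    intro y
    have hy := abs_signTest_le s y
    have habs : |t * signTest s y| ≤ 1 := by
      rw [abs_mul, abs_of_nonneg ht0]
      exact mul_le_one₀ ht (abs_nonneg _) hy
    have h2 := (abs_le.1 (Real.abs_exp_sub_one_sub_id_le habs)).2
    have h3 : (t * signTest s y) ^ 2 ≤ t ^ 2 := by
      rw [mul_pow]
      have : signTest s y ^ 2 ≤ 1 := by rw [← sq_abs]; exact pow_le_one₀ (abs_nonneg _) hy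
      nlinarith [sq_nonneg t]
    linarith
  calc ∑ y, Real.exp (t * signTest s y) ≤ ∑ y, (1 + t * signTest s y + t ^ 2) :=
        Finset.sum_le_sum fun y _ => h1 y
    _ = Fintype.card Y * (1 + t ^ 2) := by
        rw [Finset.sum_add_distrib, Finset.sum_add_distrib, ← Finset.mul_sum, sum_signTest]
        simp
        ring
    _ ≤ Fintype.card Y * Real.exp (t ^ 2) := by
        gcongr
        linarith [Real.add_one_le_exp (t ^ 2)]

/-- A Chernoff bound for the deviation of an empirical distribution from uniform. -/
theorem card_deviation_gt [Nonempty ι] [Nonempty Y] {ε : ℝ} (hε : 0 < ε) (hε1 : ε ≤ 1) :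
    ((Finset.univ.filter fun z : ι → Y => ε < deviation z).card : ℝ) *
      Real.exp (ε ^ 2 * Fintype.card ι / 4) ≤
      2 ^ Fintype.card Y * (Fintype.card Y : ℝ) ^ Fintype.card ι := by
  set m : ℝ := (Fintype.card ι : ℝ) with hm
  have hm0 : 0 ≤ m := by positivity
  -- Exponential Markov at parameter `ε / 2`, with a union over the sign tests. The moment bound
  -- costs `ε ^ 2 * m / 4` of the gain `ε ^ 2 * m / 2`.
  have h1 : ∀ z : ι → Y, (if ε < deviation z then (1 : ℝ) else 0) ≤
      ∑ s : Y → ℤˣ, Real.exp (ε / 2 * (∑ c, signTest s (z c)) - ε ^ 2 / 2 * m) := by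
    intro z
    split_ifs with hz
    · obtain ⟨s, hs⟩ := exists_signTest z
      refine le_trans ?_ (Finset.single_le_sum (fun s _ => (Real.exp_pos _).le)
        (Finset.mem_univ s))
      rw [hs, Real.one_le_exp_iff]
      have := mul_le_mul_of_nonneg_left hz.le (mul_nonneg hm0 hε.le)
      nlinarith
    · exact Finset.sum_nonneg fun s _ => (Real.exp_pos _).le
  have h2 : ∀ s : Y → ℤˣ,
      ∑ z : ι → Y, Real.exp (ε / 2 * (∑ c, signTest s (z c)) - ε ^ 2 / 2 * m) ≤
      (Fintype.card Y : ℝ) ^ Fintype.card ι * Real.exp (-(ε ^ 2 * m / 4)) := by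
    intro s
    have h3 : ∑ z : ι → Y, Real.exp (ε / 2 * (∑ c, signTest s (z c)) - ε ^ 2 / 2 * m) =
        (∏ _c : ι, ∑ y, Real.exp (ε / 2 * signTest s y)) * Real.exp (-(ε ^ 2 / 2 * m)) := by
      rw [Finset.prod_univ_sum, Fintype.piFinset_univ, Finset.sum_mul]
      refine Finset.sum_congr rfl fun z _ => ?_
      rw [← Real.exp_sum, ← Real.exp_add, Finset.mul_sum, sub_eq_add_neg]
    rw [h3, Finset.prod_const, Finset.card_univ]
    have h4 := sum_exp_signTest_le s (t := ε / 2) (by positivity) (by linarith)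
    calc _ ≤ ((Fintype.card Y : ℝ) * Real.exp ((ε / 2) ^ 2)) ^ Fintype.card ι *
            Real.exp (-(ε ^ 2 / 2 * m)) := by
          gcongr
      _ = _ := by
          rw [mul_pow, ← Real.exp_nat_mul, mul_assoc, ← Real.exp_add]
          congr 2
          rw [← hm]
          ring
  have h5 : ((Finset.univ.filter fun z : ι → Y => ε < deviation z).card : ℝ) ≤
      2 ^ Fintype.card Y * ((Fintype.card Y : ℝ) ^ Fintype.card ι *
        Real.exp (-(ε ^ 2 * m / 4))) := by
    calc ((Finset.univ.filter fun z : ι → Y => ε < deviation z).card : ℝ)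
        = ∑ z : ι → Y, if ε < deviation z then (1 : ℝ) else 0 := by simp
      _ ≤ _ := Finset.sum_le_sum fun z _ => h1 z
      _ = _ := Finset.sum_comm
      _ ≤ _ := Finset.sum_le_sum fun s _ => h2 s
      _ = _ := by simp
  calc _ ≤ 2 ^ Fintype.card Y * ((Fintype.card Y : ℝ) ^ Fintype.card ι *
        Real.exp (-(ε ^ 2 * m / 4))) * Real.exp (ε ^ 2 * m / 4) := by gcongr
    _ = _ := by
      rw [mul_assoc, mul_assoc, ← Real.exp_add, neg_add_cancel, Real.exp_zero, mul_one]

/-- Random signs make the values of the clauses nearly uniform at every assignment. -/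
theorem exists_signs {k n : ℕ} [Nonempty ι] (vars : ι → Fin k → Fin n) {ε : ℝ} (hε : 0 < ε)
    (hε1 : ε ≤ 1) (hm : 4 * ((n : ℝ) + 2 ^ k) ≤ ε ^ 2 * Fintype.card ι) :
    ∃ σ : ι → Fin k → ℤˣ, ∀ x : Fin n → ℤˣ,
      deviation (fun c j => σ c j * x (vars c j)) ≤ ε := by
  by_contra! hcon
  have hY : Fintype.card (Fin k → ℤˣ) = 2 ^ k := by simp
  set B : Finset (ι → Fin k → ℤˣ) := Finset.univ.filter fun z => ε < deviation z with hB
  have hcard : (Fintype.card (ι → Fin k → ℤˣ)) ≤ 2 ^ n * B.card := by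
    have hcov : (Finset.univ : Finset (ι → Fin k → ℤˣ)) ⊆
        (Finset.univ : Finset (Fin n → ℤˣ)).biUnion fun x =>
          Finset.univ.filter fun σ => (fun c j => σ c j * x (vars c j)) ∈ B := by
      intro σ _
      obtain ⟨x, hx⟩ := hcon σ
      exact Finset.mem_biUnion.2 ⟨x, Finset.mem_univ x, Finset.mem_filter.2 ⟨Finset.mem_univ σ,
        Finset.mem_filter.2 ⟨Finset.mem_univ _, hx⟩⟩⟩
    refine (Finset.card_le_card hcov).trans (Finset.card_biUnion_le.trans ?_)
    -- For fixed `x`, multiplication by the values of `x` is injective on signs, so each assignment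
    -- spoils at most `B.card` of them.
    have h1 : ∀ x : Fin n → ℤˣ, (Finset.univ.filter fun σ : ι → Fin k → ℤˣ =>
        (fun c j => σ c j * x (vars c j)) ∈ B).card ≤ B.card := by
      intro x
      refine Finset.card_le_card_of_injOn (fun σ c j => σ c j * x (vars c j)) ?_ ?_
      · intro σ hσ
        exact (Finset.mem_filter.1 hσ).2
      · intro σ _ τ _ h
        funext c j
        exact mul_right_cancel (congrFun (congrFun h c) j)
    refine (Finset.sum_le_sum fun x _ => h1 x).trans ?_
    simp
  have hch := card_deviation_gt (ι := ι) (Y := Fin k → ℤˣ) hε hε1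
  rw [← hB, hY] at hch
  have hcard' : ((2 ^ k : ℕ) : ℝ) ^ Fintype.card ι ≤ 2 ^ n * B.card := by
    rw [Fintype.card_fun, hY] at hcard
    exact_mod_cast hcard
  -- The Chernoff gain beats the union over `2 ^ n` assignments and `2 ^ 2 ^ k` sign tests, because
  -- `2 < e`.
  have hexp : (2 : ℝ) ^ (n + 2 ^ k) < Real.exp (ε ^ 2 * Fintype.card ι / 4) := by
    have h1 : ((n + 2 ^ k : ℕ) : ℝ) ≤ ε ^ 2 * Fintype.card ι / 4 := by push_cast; linarith
    refine lt_of_lt_of_le ?_ (Real.exp_le_exp.2 h1)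
    rw [← Real.exp_one_pow]
    exact pow_lt_pow_left₀ (by linarith [Real.exp_one_gt_d9]) (by norm_num) (by positivity)
  have hpos : (0 : ℝ) < ((2 ^ k : ℕ) : ℝ) ^ Fintype.card ι := by positivity
  have hBpos : (0 : ℝ) < B.card := by
    by_contra! h
    have : (B.card : ℝ) = 0 := le_antisymm h (by positivity)
    rw [this, mul_zero] at hcard'
    linarith
  have h6 : (B.card : ℝ) * 2 ^ (n + 2 ^ k) < 2 ^ 2 ^ k * ((2 ^ k : ℕ) : ℝ) ^ Fintype.card ι :=
    (mul_lt_mul_of_pos_left hexp hBpos).trans_le hch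
  have h7 : (2 : ℝ) ^ 2 ^ k * ((2 ^ k : ℕ) : ℝ) ^ Fintype.card ι ≤
      2 ^ 2 ^ k * (2 ^ n * B.card) := by gcongr
  rw [pow_add] at h6
  nlinarith

end Chernoff

/-! ### Random expanding hypergraphs. -/

section Hypergraph

variable {ι : Type*} [Fintype ι] [DecidableEq ι] {k N : ℕ}

/-- The assignments for which every incidence in `P` repeats an incidence of `S` outside `P`. -/
def repeating (N : ℕ) (S : Finset ι) (P : Finset (ι × Fin k)) : Finset (ι → Fin k → Fin N) :=
  {g | ∀ p ∈ P, ∃ c ∈ S, (c, p.2) ∉ P ∧ g c p.2 = g p.1 p.2}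

/-- Encode `g` by its values off `P` and, for each incidence in `P`, the edge of `S` that it copies.
The copied incidence is off `P`, so the code determines `g`. -/
theorem card_repeating_mul_le (S : Finset ι) (P : Finset (ι × Fin k)) :
    (repeating N S P).card * N ^ P.card ≤ N ^ (Fintype.card ι * k) * S.card ^ P.card := by
  have h1 : (repeating N S P).card ≤
      Fintype.card (({q // q ∉ P} → Fin N) × ({q // q ∈ P} → {c // c ∈ S})) := by
    rw [← Fintype.card_coe]
    have hex : ∀ g : {g // g ∈ repeating N S P}, ∀ p : {q // q ∈ P},
        ∃ c : {c // c ∈ S}, (c.1, p.1.2) ∉ P ∧ g.1 c.1 p.1.2 = g.1 p.1.1 p.1.2 := by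
      rintro ⟨g, hg⟩ ⟨p, hp⟩
      obtain ⟨c, hc, h⟩ := (Finset.mem_filter.1 hg).2 p hp
      exact ⟨⟨c, hc⟩, h⟩
    choose ρ hρP hρ using hex
    refine Fintype.card_le_of_injective (fun g => (fun q => g.1 q.1.1 q.1.2, ρ g)) ?_
    intro g g' h
    obtain ⟨h1, h2⟩ := Prod.ext_iff.1 h
    simp only at h1 h2
    have hout : ∀ c j, (c, j) ∉ P → g.1 c j = g'.1 c j := fun c j hcj => congrFun h1 ⟨(c, j), hcj⟩
    refine Subtype.ext ?_
    funext c j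
    by_cases hcj : (c, j) ∈ P
    · have e1 := hρ g ⟨(c, j), hcj⟩
      have e2 := hρ g' ⟨(c, j), hcj⟩
      have e3 := hout _ _ (hρP g ⟨(c, j), hcj⟩)
      rw [← h2] at e2
      exact e1.symm.trans (e3.trans e2)
    · exact hout c j hcj
  have h2 : Fintype.card {q // q ∉ P} + P.card = Fintype.card ι * k := by
    rw [Fintype.card_subtype_compl, Fintype.card_coe, Fintype.card_prod, Fintype.card_fin]
    refine Nat.sub_add_cancel ?_
    have := Finset.card_le_univ P
    simpa using this
  rw [Fintype.card_prod, Fintype.card_fun, Fintype.card_fun, Fintype.card_fin, Fintype.card_coe,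
    Fintype.card_coe] at h1
  calc _ ≤ _ := Nat.mul_le_mul_right _ h1
    _ = _ := by rw [← h2, pow_add]; ring

/-- The vertices of the `k`-partite hypergraph `g` covered by the edges in `S`. -/
def covered (g : ι → Fin k → Fin N) (S : Finset ι) : Finset (Fin k × Fin N) :=
  (S ×ˢ Finset.univ).image fun p => (p.2, g p.1 p.2)

/-- Keep one incidence for each covered vertex and let `P` be the rest; every incidence in `P`
repeats a kept one. -/
theorem exists_repeating (g : ι → Fin k → Fin N) (S : Finset ι)
    (hS : 4 * (covered g S).card + 5 * S.card < 4 * (k * S.card)) :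
    ∃ P ⊆ S ×ˢ (Finset.univ : Finset (Fin k)), 5 * S.card ≤ 4 * P.card ∧ g ∈ repeating N S P := by
  classical
  set φ : ι × Fin k → Fin k × Fin N := fun p => (p.2, g p.1 p.2) with hφ
  have hsurj : Set.SurjOn φ (S ×ˢ (Finset.univ : Finset (Fin k)) : Finset (ι × Fin k))
      (covered g S : Finset (Fin k × Fin N)) := by
    intro w hw
    simpa [covered] using hw
  obtain ⟨u, hu, hinj, himg⟩ := hsurj.exists_subset_injOn_image_eq
  set R : Finset (ι × Fin k) := (S ×ˢ Finset.univ).filter (· ∈ u) with hR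
  have hRu : (R : Set (ι × Fin k)) = u := by
    ext p
    simp only [hR, Finset.coe_filter, Set.mem_ofPred_eq]
    exact ⟨fun h => h.2, fun h => ⟨hu h, h⟩⟩
  have hRimg : R.image φ = covered g S := by
    rw [← Finset.coe_inj, Finset.coe_image, hRu, himg]
  have hRcard : R.card = (covered g S).card := by
    rw [← hRimg, Finset.card_image_of_injOn (by rw [hRu]; exact hinj)]
  have hRS : R ⊆ S ×ˢ Finset.univ := Finset.filter_subset _ _
  refine ⟨(S ×ˢ Finset.univ) \ R, Finset.sdiff_subset, ?_, ?_⟩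
  · rw [Finset.card_sdiff_of_subset hRS, Finset.card_product, Finset.card_univ, Fintype.card_fin,
      hRcard, mul_comm S.card k]
    omega
  · simp only [repeating, Finset.mem_filter, Finset.mem_univ, true_and]
    rintro ⟨c, j⟩ hp
    rw [Finset.mem_sdiff] at hp
    have hmem : φ (c, j) ∈ R.image φ := by
      rw [hRimg]
      exact Finset.mem_image_of_mem φ hp.1
    obtain ⟨⟨c', j'⟩, hq, hqe⟩ := Finset.mem_image.1 hmem
    simp only [hφ, Prod.mk.injEq] at hqe
    obtain ⟨rfl, h⟩ := hqe
    exact ⟨c', (Finset.mem_product.1 (hRS hq)).1, fun h' => (Finset.mem_sdiff.1 h').2 hq, h⟩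

theorem choose_mul_pow_le (m t : ℕ) : (m.choose t : ℝ) * t ^ t ≤ (3 * m) ^ t := by
  have h1 : (m.choose t : ℝ) ≤ m ^ t / t.factorial := Nat.choose_le_pow_div t m
  have h2 : (t : ℝ) ^ t / t.factorial ≤ Real.exp t :=
    Real.pow_div_factorial_le_exp _ (by positivity) t
  have h3 : Real.exp t ≤ 3 ^ t := by
    rw [← Real.exp_one_pow]
    exact pow_le_pow_left₀ (Real.exp_pos _).le (by linarith [Real.exp_one_lt_d9]) t
  calc (m.choose t : ℝ) * t ^ t ≤ m ^ t / t.factorial * t ^ t := by gcongr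
    _ = m ^ t * (t ^ t / t.factorial) := by ring
    _ ≤ m ^ t * 3 ^ t := by gcongr; exact h2.trans h3
    _ = _ := by rw [mul_pow, mul_comm]

/-- Each incidence in `P` contributes a factor `S.card / N`, at most `θ ^ 4`. The first `S.card` of
them are kept as they are, and the surplus of at least a quarter as many yields `θ ^ S.card`. -/
theorem card_repeating_le {S : Finset ι} {P : Finset (ι × Fin k)} {θ : ℝ} (hN : 0 < N)
    (hθ0 : 0 ≤ θ) (hθ1 : θ ≤ 1) (hS : (S.card : ℝ) ≤ θ ^ 4 * N) (hP : 5 * S.card ≤ 4 * P.card) :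
    ((repeating N S P).card : ℝ) ≤
      (N : ℝ) ^ (Fintype.card ι * k) * (S.card * θ / N) ^ S.card := by
  have hN' : (0 : ℝ) < N := by exact_mod_cast hN
  have h1 : ((repeating N S P).card : ℝ) * N ^ P.card ≤
      (N : ℝ) ^ (Fintype.card ι * k) * S.card ^ P.card := by
    exact_mod_cast card_repeating_mul_le S P
  have h2 : ((repeating N S P).card : ℝ) ≤
      (N : ℝ) ^ (Fintype.card ι * k) * (S.card / N) ^ P.card := by
    rw [div_pow, ← mul_div_assoc, le_div_iff₀ (by positivity)]
    exact h1
  refine h2.trans ?_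
  gcongr
  set t := S.card
  obtain ⟨l, hl⟩ : ∃ l, P.card = t + l := ⟨P.card - t, by omega⟩
  have h3 : (t : ℝ) / N ≤ θ ^ 4 := by rwa [div_le_iff₀ hN']
  have h4 : ((t : ℝ) / N) ^ l ≤ θ ^ t := by
    calc ((t : ℝ) / N) ^ l ≤ (θ ^ 4) ^ l := by gcongr
      _ = θ ^ (4 * l) := by rw [pow_mul]
      _ ≤ θ ^ t := pow_le_pow_of_le_one hθ0 hθ1 (by omega)
  rw [hl, pow_add, mul_div_right_comm, mul_pow]
  gcongr

/-- The probabilistic construction of an expanding `k`-partite hypergraph. -/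
theorem exists_expanding (ι : Type*) [Fintype ι] [DecidableEq ι] (k N r : ℕ) {θ : ℝ} (hN : 0 < N)
    (hθ0 : 0 ≤ θ) (hθ1 : θ ≤ 1) (hr : (r : ℝ) ≤ θ ^ 4 * N)
    (hm : 12 * 2 ^ k * θ * Fintype.card ι ≤ N) :
    ∃ g : ι → Fin k → Fin N, ∀ S : Finset ι, S.card ≤ r →
      4 * (k * S.card) ≤ 4 * (covered g S).card + 5 * S.card := by
  by_contra! hcon
  have hN' : (0 : ℝ) < N := by exact_mod_cast hN
  set m := Fintype.card ι with hmd
  set Z : ℝ := (N : ℝ) ^ (m * k) with hZ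
  have hZpos : 0 < Z := by positivity
  let 𝒮 : Finset (Finset ι) := Finset.univ.filter fun S => 1 ≤ S.card ∧ S.card ≤ r
  let 𝒬 : Finset ι → Finset (Finset (ι × Fin k)) := fun S =>
    (S ×ˢ (Finset.univ : Finset (Fin k))).powerset.filter fun P => 5 * S.card ≤ 4 * P.card
  have hcov : (Finset.univ : Finset (ι → Fin k → Fin N)) ⊆
      𝒮.biUnion fun S => (𝒬 S).biUnion fun P => repeating N S P := by
    intro g _
    obtain ⟨S, hS, hlt⟩ := hcon g
    obtain ⟨P, hPS, hP, hg⟩ := exists_repeating g S hlt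
    have hS1 : 1 ≤ S.card := by
      by_contra! h
      have : S.card = 0 := by omega
      simp [this] at hlt
    exact Finset.mem_biUnion.2 ⟨S, Finset.mem_filter.2 ⟨Finset.mem_univ S, hS1, hS⟩,
      Finset.mem_biUnion.2 ⟨P, Finset.mem_filter.2 ⟨Finset.mem_powerset.2 hPS, hP⟩, hg⟩⟩
  have hZcard : Z = ((Finset.univ : Finset (ι → Fin k → Fin N)).card : ℝ) := by
    rw [Finset.card_univ, Fintype.card_fun, Fintype.card_fun, Fintype.card_fin, Fintype.card_fin,
      ← pow_mul, mul_comm k]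
    push_cast
    rfl
  -- Bounds the assignments for which a given set of `t` edges fails to expand; `2 ^ (t * k)` counts
  -- the choices of `P`.
  let f : ℕ → ℝ := fun t => 2 ^ (t * k) * (Z * (t * θ / N) ^ t)
  have hf0 : ∀ t, 0 ≤ f t := fun t => by positivity
  have hS : ∀ S ∈ 𝒮, (((𝒬 S).biUnion fun P => repeating N S P).card : ℝ) ≤ f S.card := by
    intro S hS
    have hSr : (S.card : ℝ) ≤ θ ^ 4 * N :=
      le_trans (by exact_mod_cast (Finset.mem_filter.1 hS).2.2) hr
    calc (((𝒬 S).biUnion fun P => repeating N S P).card : ℝ)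
        ≤ ∑ P ∈ 𝒬 S, ((repeating N S P).card : ℝ) := by exact_mod_cast Finset.card_biUnion_le
      _ ≤ ∑ P ∈ 𝒬 S, Z * (S.card * θ / N) ^ S.card :=
          Finset.sum_le_sum fun P hP =>
            card_repeating_le hN hθ0 hθ1 hSr (Finset.mem_filter.1 hP).2
      _ = (𝒬 S).card * (Z * (S.card * θ / N) ^ S.card) := by rw [Finset.sum_const, nsmul_eq_mul]
      _ ≤ f S.card := by
          have h1 : (𝒬 S).card ≤ 2 ^ (S.card * k) := by
            refine (Finset.card_filter_le _ _).trans (le_of_eq ?_)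
            rw [Finset.card_powerset, Finset.card_product, Finset.card_univ, Fintype.card_fin]
          have h2 : ((𝒬 S).card : ℝ) ≤ 2 ^ (S.card * k) := by exact_mod_cast h1
          simp only [f]
          gcongr
  have hterm : ∀ t, (m.choose t : ℝ) * f t ≤ Z * (1 / 4) ^ t := by
    intro t
    calc (m.choose t : ℝ) * f t = Z * ((m.choose t * t ^ t) * (2 ^ k * θ / N) ^ t) := by
          simp only [f]
          rw [mul_comm t k, pow_mul]
          simp only [div_pow, mul_pow]
          ring
      _ ≤ Z * ((3 * m) ^ t * (2 ^ k * θ / N) ^ t) := by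
          gcongr
          exact choose_mul_pow_le m t
      _ = Z * (3 * m * (2 ^ k * θ / N)) ^ t := by rw [mul_pow (3 * (m : ℝ))]
      _ ≤ Z * (1 / 4) ^ t := by
          gcongr
          rw [← mul_div_assoc, div_le_iff₀ hN']
          linarith
  -- If every assignment failed, `Z` would be at most this geometric sum over `t ≥ 1`, which is at
  -- most `Z / 3`.
  have hmain : Z ≤ ∑ t ∈ Finset.range (m + 1), if 1 ≤ t then Z * (1 / 4) ^ t else 0 := by
    calc Z ≤ ∑ S ∈ 𝒮, (((𝒬 S).biUnion fun P => repeating N S P).card : ℝ) := by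
          rw [hZcard]
          exact_mod_cast (Finset.card_le_card hcov).trans Finset.card_biUnion_le
      _ ≤ ∑ S ∈ 𝒮, f S.card := Finset.sum_le_sum hS
      _ ≤ ∑ S : Finset ι, if 1 ≤ S.card then f S.card else 0 := by
          rw [Finset.sum_filter]
          refine Finset.sum_le_sum fun S _ => ?_
          by_cases h1 : 1 ≤ S.card <;> by_cases h2 : S.card ≤ r <;> simp [h1, h2, hf0]
      _ = ∑ t ∈ Finset.range (m + 1), (m.choose t) • (if 1 ≤ t then f t else 0) := by
          rw [← Finset.powerset_univ,
            Finset.sum_powerset_apply_card (fun t => if 1 ≤ t then f t else 0), Finset.card_univ]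
      _ ≤ _ := by
          refine Finset.sum_le_sum fun t _ => ?_
          split_ifs
          · rw [nsmul_eq_mul]
            exact hterm t
          · simp
  have hgeom : (∑ t ∈ Finset.range (m + 1), if 1 ≤ t then Z * (1 / 4 : ℝ) ^ t else 0) ≤ Z / 3 := by
    rw [Finset.sum_range_succ']
    simp only [le_add_iff_nonneg_left, zero_le, if_true, Nat.one_le_iff_ne_zero, ne_eq,
      not_true_eq_false, if_false, add_zero, ← Finset.mul_sum, pow_succ, ← Finset.sum_mul]
    rw [geom_sum_eq (by norm_num)]
    have : (0 : ℝ) ≤ (1 / 4) ^ m := by positivity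
    have h1 := mul_nonneg hZpos.le this
    have h2 : Z * (((1 / 4 : ℝ) ^ m - 1) / (1 / 4 - 1) * (1 / 4)) = (Z - Z * (1 / 4) ^ m) / 3 := by
      ring
    rw [h2]
    linarith
  linarith

end Hypergraph

/-! ### Assembling the instances. -/

section Instances

variable {ι : Type*} [Fintype ι] [DecidableEq ι] [Nonempty ι] {k n : ℕ}

theorem inducedDist_apply (I : Finset (Clause k n)) (hI : I.Nonempty) (x : Fin n → ℤˣ)
    (y : Fin k → ℤˣ) :
    (inducedDist I hI x y).toReal = ∑ C ∈ I, if C.eval x = y then 1 / (I.card : ℝ) else 0 := by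
  classical
  rw [inducedDist, PMF.map_apply, tsum_eq_sum (s := I), ENNReal.toReal_sum]
  · refine Finset.sum_congr rfl fun C hC => ?_
    rw [PMF.uniformOfFinset_apply_of_mem hI hC]
    by_cases h : C.eval x = y
    · simp [h]
    · simp [h, Ne.symm h]
  · intro C hC
    rw [PMF.uniformOfFinset_apply_of_mem hI hC]
    split_ifs
    · simp [hI.ne_empty]
    · simp
  · intro C hC
    simp [PMF.uniformOfFinset_apply_of_notMem hI hC]

theorem statDist_inducedDist [DecidableEq (Clause k n)] {Cl : ι → Clause k n}
    (hCl : Function.Injective Cl) (hI : (Finset.univ.image Cl).Nonempty) (x : Fin n → ℤˣ) :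
    statDist (inducedDist (Finset.univ.image Cl) hI x) (PMF.uniformOfFintype (Fin k → ℤˣ)) =
      deviation fun c => (Cl c).eval x := by
  rw [statDist, deviation]
  congr 1
  refine Finset.sum_congr rfl fun y _ => ?_
  rw [inducedDist_apply, Finset.sum_image fun a _ b _ h => hCl h,
    Finset.card_image_of_injective _ hCl, Finset.card_univ, Finset.card_filter]
  congr 2
  · rw [Nat.cast_sum, Finset.sum_div]
    refine Finset.sum_congr rfl fun c _ => ?_
    split_ifs <;> simp
  · simp

open Classical in
theorem exists_instance {Cl : ι → Clause k n} (hCl : Function.Injective Cl)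
    (hvars : ∀ c, Function.Injective (Cl c).vars) {ε : ℝ} {d : ℕ} (hd : 2 ≤ d) (hk : k ≤ d)
    (hdev : ∀ x, deviation (fun c => (Cl c).eval x) ≤ ε)
    (hexp : ∀ (μ : PMF (Fin k → ℤˣ)) (hμ : IsPairwiseIndependent μ),
      (clauseSystem Cl hvars hμ).Expands (12 * d)) :
    ∃ (I : Finset (Clause k n)) (hI : I.Nonempty),
      (∀ x : Fin n → ℤˣ,
        statDist (inducedDist I hI x) (PMF.uniformOfFintype (Fin k → ℤˣ)) ≤ ε) ∧
      ∀ μ : PMF (Fin k → ℤˣ), IsPairwiseIndependent μ →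
        ∃ E : PolyLE n d →ₗ[ℝ] ℝ, IsPseudoExpectation E ∧
          (∀ j : Fin n, Satisfies E (MvPolynomial.X j ^ 2 - 1)) ∧
          ∀ C ∈ I, ∀ f : (Fin k → ℤˣ) → ℝ,
            ∃ h : C.poly f ∈ PolyLE n d, E ⟨C.poly f, h⟩ = expect μ f := by
  refine ⟨Finset.univ.image Cl, Finset.univ_nonempty.image Cl, fun x => ?_, fun μ hμ => ?_⟩
  · rw [statDist_inducedDist hCl]
    exact hdev x
  · obtain ⟨E, h1, h2, h3⟩ := exists_pseudoExpectation Cl hvars hμ hd hk (hexp μ hμ)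
    refine ⟨E, h1, h2, fun C hC f => ?_⟩
    obtain ⟨c, -, rfl⟩ := Finset.mem_image.1 hC
    exact h3 c f

/-- A character of size at least three does not fit into `k ≤ 2` variables, so all constraints are
trivial and `Expands` is vacuous, even when clauses share all their variables. -/
theorem expands_of_le_two {V ι : Type*} [Fintype V] [DecidableEq V] [Fintype ι] [DecidableEq ι]
    (Φ : ConstraintSystem V ι k) (hk : k ≤ 2) (r : ℕ) : Φ.Expands r := by
  rintro S - ⟨c, -, T, hT0, hT⟩
  have h1 := Φ.three_le_card c T hT hT0
  have h2 := Finset.card_le_card (Φ.fsupp_subset c T hT)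
  rw [Φ.card_nbr] at h2
  omega

/-- All the clauses on the first `k` variables. -/
def initialClause (h : k ≤ n) (σ : Fin k → ℤˣ) : Clause k n := fun j => ⟨Fin.castLE h j, σ j⟩

theorem deviation_initialClause (h : k ≤ n) (x : Fin n → ℤˣ) :
    deviation (fun σ => (initialClause h σ).eval x) = 0 := by
  have h1 : ∀ y : Fin k → ℤˣ,
      (Finset.univ.filter fun σ => (initialClause h σ).eval x = y).card = 1 := by
    intro y
    rw [Finset.card_eq_one]
    refine ⟨fun j => y j * (x (Fin.castLE h j))⁻¹, ?_⟩
    ext σ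
    simp only [Finset.mem_filter, Finset.mem_univ, true_and, Finset.mem_singleton, funext_iff,
      Clause.eval, Literal.eval, initialClause, eq_mul_inv_iff_mul_eq]
  simp [deviation, h1]

variable {N : ℕ}

/-- The clauses given by a `k`-partite hypergraph and signs. -/
def partiteClause (e : Fin k × Fin N → Fin n) (g : ι → Fin k → Fin N) (σ : ι → Fin k → ℤˣ)
    (c : ι) : Clause k n := fun j => ⟨e (j, g c j), σ c j⟩

theorem partiteClause_vars_injective {e : Fin k × Fin N → Fin n} (he : Function.Injective e)
    (g : ι → Fin k → Fin N) (σ : ι → Fin k → ℤˣ) (c : ι) :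
    Function.Injective (partiteClause e g σ c).vars := by
  intro i j h
  exact (Prod.ext_iff.1 (he h)).1

/-- Two equal edges cover only `k` vertices, and `8 * k ≤ 4 * k + 10` fails for `k ≥ 3`. -/
theorem partiteClause_injective {e : Fin k × Fin N → Fin n} (he : Function.Injective e)
    {g : ι → Fin k → Fin N} (σ : ι → Fin k → ℤˣ) {r : ℕ} (hk : 3 ≤ k) (hr : 2 ≤ r)
    (hg : ∀ S : Finset ι, S.card ≤ r →
      4 * (k * S.card) ≤ 4 * (covered g S).card + 5 * S.card) :
    Function.Injective (partiteClause e g σ) := by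
  intro c c' h
  by_contra hne
  have h1 : g c = g c' := by
    funext j
    have := congrArg Literal.var (congrFun h j)
    exact (Prod.ext_iff.1 (he this)).2
  have h2 := hg {c, c'} (by rw [Finset.card_pair hne]; exact hr)
  have h3 : (covered g {c, c'}).card ≤ k := by
    have hsub : covered g {c, c'} ⊆ Finset.univ.image fun j => (j, g c j) := by
      intro w hw
      obtain ⟨⟨b, j⟩, hb, rfl⟩ := Finset.mem_image.1 hw
      have hb' := (Finset.mem_product.1 hb).1
      simp only [Finset.mem_insert, Finset.mem_singleton] at hb'
      refine Finset.mem_image.2 ⟨j, Finset.mem_univ j, ?_⟩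
      rcases hb' with rfl | rfl
      · rfl
      · rw [h1]
    exact (Finset.card_le_card hsub).trans (Finset.card_image_le.trans (by simp))
  rw [Finset.card_pair hne] at h2
  omega

theorem expands_partiteClause {e : Fin k × Fin N → Fin n} (he : Function.Injective e)
    {g : ι → Fin k → Fin N} (σ : ι → Fin k → ℤˣ) {r : ℕ}
    (hg : ∀ S : Finset ι, S.card ≤ r →
      4 * (k * S.card) ≤ 4 * (covered g S).card + 5 * S.card)
    {μ : PMF (Fin k → ℤˣ)} (hμ : IsPairwiseIndependent μ) :
    (clauseSystem (partiteClause e g σ) (partiteClause_vars_injective he g σ) hμ).Expands r := by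
  intro S hS _
  have h1 : (clauseSystem (partiteClause e g σ) (partiteClause_vars_injective he g σ) hμ).nbrs S =
      (covered g S).image e := by
    ext v
    simp only [ConstraintSystem.nbrs, clauseSystem, covered, Finset.mem_biUnion, Finset.mem_image,
      Finset.mem_univ, true_and, Finset.mem_product, and_true, Prod.exists]
    constructor
    · rintro ⟨c, hc, j, rfl⟩
      exact ⟨j, g c j, ⟨c, j, hc, rfl⟩, rfl⟩
    · rintro ⟨_, _, ⟨c, j, hc, h⟩, rfl⟩
      refine ⟨c, hc, j, ?_⟩
      rw [← h]
      rfl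
  rw [h1, Finset.card_image_of_injective _ he]
  exact hg S hS

end Instances

end SOS
end

/-! ### The main theorem: choice of parameters. -/

theorem theorem1 (k : ℕ) (ε : ℝ) (hε : 0 < ε) :
    ∃ δ : ℝ, 0 < δ ∧ ∀ᶠ n : ℕ in Filter.atTop,
      ∃ (I : Finset (SOS.Clause k n)) (hI : I.Nonempty),
        (∀ x : Fin n → ℤˣ,
          SOS.statDist (SOS.inducedDist I hI x) (PMF.uniformOfFintype (Fin k → ℤˣ)) ≤ ε) ∧
        ∀ μ : PMF (Fin k → ℤˣ), SOS.IsPairwiseIndependent μ →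
          ∃ E : SOS.PolyLE n ⌊δ * (n : ℝ)⌋₊ →ₗ[ℝ] ℝ,
            SOS.IsPseudoExpectation E ∧
            (∀ j : Fin n, SOS.Satisfies E (MvPolynomial.X j ^ 2 - 1)) ∧
            ∀ C ∈ I, ∀ f : (Fin k → ℤˣ) → ℝ,
              ∃ h : C.poly f ∈ SOS.PolyLE n ⌊δ * (n : ℝ)⌋₊,
                E ⟨C.poly f, h⟩ = SOS.expect μ f := by
  rcases Nat.lt_or_ge 2 k with hk | hk
  · set ε' : ℝ := min ε 1 with hε'
    have hε0 : 0 < ε' := lt_min hε one_pos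
    -- There will be `M * n` clauses, so that `4 * (n + 2 ^ k) ≤ 8 * n ≤ ε' ^ 2 * M * n` once `2 ^ k
    -- ≤ n`.
    obtain ⟨M, hM⟩ := exists_nat_ge (8 / ε' ^ 2)
    have hM0 : (0 : ℝ) < M := lt_of_lt_of_le (by positivity) hM
    have hk0 : (0 : ℝ) < k := by exact_mod_cast (by omega : 0 < k)
    -- With `n ≤ 2 * k * N` this is the density condition of `exists_expanding` for `M * n` edges.
    set θ : ℝ := (12 * 2 ^ k * (2 * k * M))⁻¹ with hθ
    have hθ0 : 0 < θ := by positivity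
    have hθ1 : θ ≤ 1 := by
      refine inv_le_one_of_one_le₀ ?_
      have h1 : (1 : ℝ) ≤ M := by
        have : 0 < M := by exact_mod_cast hM0
        exact_mod_cast this
      have h2 : (1 : ℝ) ≤ k := by exact_mod_cast (by omega : 1 ≤ k)
      have h3 : (1 : ℝ) ≤ 2 ^ k := one_le_pow₀ (by norm_num)
      have h4 : (1 : ℝ) ≤ k * M := one_le_mul_of_one_le_of_one_le h2 h1
      have h5 : (1 : ℝ) ≤ 2 ^ k * (k * M) := one_le_mul_of_one_le_of_one_le h3 h4
      linarith
    -- Chosen so that `12 * δ * n ≤ θ ^ 4 * N`, which makes the expansion range reach `12 * d`.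
    set δ : ℝ := θ ^ 4 / (24 * k) with hδ
    have hδ0 : 0 < δ := by positivity
    refine ⟨δ, hδ0, ?_⟩
    obtain ⟨n₀, hn₀⟩ := exists_nat_ge (k / δ)
    filter_upwards [Filter.eventually_ge_atTop n₀, Filter.eventually_ge_atTop (2 ^ k),
      Filter.eventually_ge_atTop k] with n hn1 hn2 hn3
    set d : ℕ := ⌊δ * (n : ℝ)⌋₊ with hd
    have hkd : k ≤ d := by
      refine Nat.le_floor ?_
      have h1 : (k : ℝ) / δ ≤ n := hn₀.trans (by exact_mod_cast hn1)
      rwa [div_le_iff₀ hδ0, mul_comm] at h1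
    have hdn : (d : ℝ) ≤ δ * n := Nat.floor_le (by positivity)
    set N : ℕ := n / k with hNd
    have hN : 0 < N := Nat.div_pos hn3 (by omega)
    have hnN : (n : ℝ) ≤ 2 * k * N := by
      have h1 : n < k * (n / k) + k := by
        have := Nat.div_add_mod n k
        have := Nat.mod_lt n (by omega : k > 0)
        omega
      have h2 : k * 1 ≤ k * (n / k) := Nat.mul_le_mul_left k hN
      have h3 : n ≤ 2 * k * N := by rw [mul_assoc, hNd]; omega
      exact_mod_cast h3
    have hn0 : 0 < n := by omega
    have hm0 : 0 < M * n := Nat.mul_pos (by exact_mod_cast hM0) hn0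
    have : Nonempty (Fin (M * n)) := ⟨⟨0, hm0⟩⟩
    obtain ⟨g, hg⟩ := SOS.exists_expanding (Fin (M * n)) k N (12 * d) hN hθ0.le hθ1
      (by
        push_cast
        calc 12 * (d : ℝ) ≤ 12 * (δ * (2 * k * N)) := by gcongr; exact hdn.trans (by gcongr)
          _ = θ ^ 4 * N := by rw [hδ]; field_simp; ring)
      (by
        rw [Fintype.card_fin]
        push_cast
        calc 12 * 2 ^ k * θ * (M * n : ℝ) ≤ 12 * 2 ^ k * θ * (M * (2 * k * N)) := by gcongr
          _ = N := by rw [hθ]; field_simp)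
    -- Each clause position gets its own block of `N = n / k` variables, which keeps the variables
    -- of a clause distinct.
    let e : Fin k × Fin N → Fin n := fun p => Fin.castLE (Nat.mul_div_le n k) (finProdFinEquiv p)
    have he : Function.Injective e :=
      (Fin.castLE_injective _).comp finProdFinEquiv.injective
    obtain ⟨σ, hσ⟩ := SOS.exists_signs (fun c j => e (j, g c j)) hε0 (min_le_right _ _)
      (by
        rw [Fintype.card_fin]
        push_cast
        have h1 : (2 : ℝ) ^ k ≤ n := by exact_mod_cast hn2
        have h2 : 8 ≤ ε' ^ 2 * M := by
          rwa [div_le_iff₀ (by positivity), mul_comm] at hM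
        calc 4 * ((n : ℝ) + 2 ^ k) ≤ 8 * n := by linarith
          _ ≤ ε' ^ 2 * M * n := by gcongr
          _ = _ := by ring)
    exact SOS.exists_instance (SOS.partiteClause_injective he σ hk (by omega) hg)
      (SOS.partiteClause_vars_injective he g σ) (by omega) hkd
      (fun x => (hσ x).trans (min_le_left _ _))
      fun μ hμ => SOS.expands_partiteClause he σ hg hμ
  -- For `k ≤ 2`, all sign patterns on the same `k` variables give exactly uniform values, and
  -- expansion is vacuous.
  · refine ⟨1, one_pos, ?_⟩
    filter_upwards [Filter.eventually_ge_atTop 2] with n hn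
    have hd : ⌊(1 : ℝ) * (n : ℝ)⌋₊ = n := by rw [one_mul, Nat.floor_natCast]
    have hkn : k ≤ n := hk.trans hn
    refine SOS.exists_instance (Cl := SOS.initialClause hkn) ?_ ?_ (hd.symm ▸ hn) (hd.symm ▸ hkn)
      (fun x => (SOS.deviation_initialClause hkn x).trans_le hε.le)
      fun μ hμ => SOS.expands_of_le_two _ hk _
    · intro σ τ h
      funext j
      exact congrArg SOS.Literal.sign (congrFun h j)
    · intro σ
      exact Fin.castLE_injective hkn
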